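/- **Model.** There are $n\ge1$ products, $m\ge1$ stages, a stage capacity $d\ge1$, and each product can be shown at most $w\ge1$ times. An assortment is $\mathbf x=(x_{i,k,z})\in\{0,1\}^{n\times w\times m}$, where $x_{i,k,z}=1$ means that the $k$-th exposure of product $i$ is displayed in stage $z$. It is feasible ($\mathbf x\in\mathcal X$) if $\sum_k x_{i,k,z}\le 1$ for all $i,z$; $x_{i,s,z}\sum_{z'=1}^{z}\sum_{k=1}^{s}x_{i,k,z'}=x_{i,s,z}\,s$ for all $i,s,z$ (exposures occur in order); and $\sum_{i,k}x_{i,k,z}\le d$ for all $z$. Product $i$ has patience cost $c_i\ge0$ and revenue $r_i>0$. The utilities $U_{i,k}\sim\mathrm{Gumbel}(\mu_{i,k},1)$, $U_0\sim\mathrm{Gumbel}(0,1)$ and the patience budget $B\ge0$ are independent. The consumer browses stage by stage, starting with stage 1; if some product of the current stage has utility larger than $U_0$ she buys the one of largest utility and leaves; otherwise she goes on to the next stage if and only if the total patience cost of everything browsed so far is at most $B$. Let $p_{it}(\mathbf x)$ be the probability that she buys $i$ in stage $t$, $f(\mathbf x)=\sum_{t,i}p_{it}(\mathbf x)r_i$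 the expected revenue, and $F(q)=P(B\ge q)$. Assume that $P(B\ge q_1+q_2\mid B\ge q_1)\le F(q_2)$ for all $q_1,q_2\ge0$ with $F(q_1)>0$, and that $\mu_{i,k}\ge\mu_{i,k+1}$ for all $i$ and $1\le k<w$. Problem **P.0** is to maximize $f$ over $\mathcal X$. **Algorithm ACME** with parameters $\rho\in[0,1]$, $\varepsilon>0$. Let $\beta_{i,k}=e^{\mu_{i,k}}$, $\gamma_{i,k}=r_i\beta_{i,k}$, let $\beta_{\min},\beta_{\max},\gamma_{\min},\gamma_{\max}$ be their extreme values, and $$g(\mathbf x)=\sum_{t=1}^m\frac{\sum_{i,k}\gamma_{i,k}x_{i,k,t}}{\bigl(1+\sum_{z<t}\sum_{i,k}\beta_{i,k}x_{i,k,z}\bigr)\bigl(1+\sum_{z\le t}\sum_{i,k}\beta_{i,k}x_{i,k,z}\bigr)} .$$ 1. (Dynamic program for **P.1**: maximize $g(\mathbf x)$ over $\mathbf x\in\mathcal X$ with $F(\sum_{i,k,z}c_ix_{i,k,z})\ge\rho$.) Let $I=\{\gamma_{\min}(1+\varepsilon)^a: 1\le a\le\max(1,\lceil\log_{1+\varepsilon}\frac{d\gamma_{\max}}{\varepsilon\gamma_{\min}}\rceil)\}$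 and define $J$ in the same way from $\beta_{\min},\beta_{\max}$. For a guess $(\boldsymbol\mu,\boldsymbol\nu)\in I^m\times J^m$ put $\tilde\gamma_{i,k,z}=\lceil\gamma_{i,k}/(\mu_z\varepsilon/d)\rceil$ and $\tilde\beta_{i,k,z}=\lfloor\beta_{i,k}/(\nu_z\varepsilon/d)\rfloor$. For $\mathbf u,\mathbf v,\mathbf l\in\mathbb Z^m$ let $h(0,\mathbf 0,\mathbf 0,\mathbf 0)=0$, let $h(j,\mathbf u,\mathbf v,\mathbf l)=+\infty$ if some coordinate is negative or if $j=0$ and some coordinate is nonzero, and otherwise let $$h(j,\mathbf u,\mathbf v,\mathbf l)=\min_{\mathbf y}\bigl[h(j-1,\mathbf u-\mathbf y\tilde\gamma_j,\mathbf v-\mathbf y\tilde\beta_j,\mathbf l-\mathbf y)+|\mathbf y|_1c_j\bigr],$$ where $\mathbf y\in\{0,1\}^m$ ranges over the schedules of product $j$ with $|\mathbf y|_1\le w$, and $\mathbf y\tilde\gamma_j$, $\mathbf y\tilde\beta_j$ replace the $k$-th nonzero entry of $\mathbf y$, in position $z$, by $\tilde\gamma_{j,k,z}$, $\tilde\beta_{j,k,z}$.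 For every guess and every $(\mathbf u,\mathbf v,\mathbf l)$ with $0\le u_z,v_z\le d(d/\varepsilon+1)$, $0\le l_z\le d$ and $h(n,\mathbf u,\mathbf v,\mathbf l)<\infty$, trace back one assortment attaining the minima. Let $\mathbf x'$ be one with the largest $g$ among those traced-back assortments that satisfy $F(\sum_{i,k,z}c_ix_{i,k,z})\ge\rho$. 2. Let $\mathbf x''$ be an optimal solution of **P.0** with $m=1$ (used as first stage, with the other stages empty). 3. Return the one of $\mathbf x',\mathbf x''$ with the larger $f$. **Statement.** For all $\rho\in[0,1]$ and $\varepsilon>0$, ACME has an output, and every output of ACME (however ties are broken) is a feasible assortment $\mathbf x$ with $$f(\mathbf x)\ \ge\ \frac{\rho(1-\rho)\bigl(1-\varepsilon(1+\varepsilon)\bigr)}{2\bigl(1+\varepsilon(1+\varepsilon)\bigr)^2}\,f(\mathbf y)\qquad\text{for all }\mathbf y\in\mathcal X .$$ -/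

import Mathlib

open MeasureTheory ProbabilityTheory

noncomputable section

namespace Cascade

/-! ### Assortments -/

/-- `x i k z = true` means: the `(k+1)`-th exposure of product `i` is displayed in stage `z`
(products, exposures and stages are numbered from `0`). -/
abbrev Assortment (n w m : ℕ) : Type := Fin n → Fin w → Fin m → Bool

/-- Feasible assortments with stage capacity `d`. -/
structure Feasible {n w m : ℕ} (d : ℕ) (x : Assortment n w m) : Prop where
  /-- a product is displayed at most once in each stage -/
  once : ∀ z i, ∑ k, (x i k z).toNat ≤ 1
  /-- if the `(s+1)`-th exposure of `i` is displayed in stage `z`, then exactly `s+1` of the first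
  `s+1` exposures of `i` have been displayed up to (and including) stage `z` -/
  order : ∀ i s z,
    (x i s z).toNat * (∑ z' ∈ Finset.Iic z, ∑ k ∈ Finset.Iic s, (x i k z').toNat) =
      (x i s z).toNat * (s.val + 1)
  /-- at most `d` products are displayed in each stage -/
  capacity : ∀ z, ∑ i, ∑ k, (x i k z).toNat ≤ d

/-- The `m`-stage assortment that displays a one-stage assortment in the first stage and nothing
afterwards. -/
def inFirstStage {n w : ℕ} (m : ℕ) (x : Assortment n w 1) : Assortment n w m :=
  fun i k z => if z.val = 0 then x i k 0 else false

/-! ### The cascade multinomial logit model -/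

/-- The Gumbel distribution with location `a` and scale `1`. -/
def gumbel (a : ℝ) : Measure ℝ :=
  volume.withDensity fun s => ENNReal.ofReal (Real.exp (-(s - a)) * Real.exp (-Real.exp (-(s - a))))

/-- The data of a cascade multinomial logit model with `n` products and at most `w` exposures of
each product. -/
structure Model (n w : ℕ) where
  /-- location of the Gumbel utility of the exposures of a product -/
  loc : Fin n → Fin w → ℝ
  /-- patience cost of a product -/
  cost : Fin n → ℝ
  /-- revenue of a product -/
  rev : Fin n → ℝ
  /-- law of the patience budget of a consumer -/
  budget : Measure ℝ

namespace Model

variable {n w m : ℕ} (M : Model n w)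

/-- `F q`, the probability that the patience budget is at least `q`. -/
def survival (q : ℝ) : ℝ := M.budget.real (Set.Ici q)

/-- `P(B ≥ q₁ + q₂ ∣ B ≥ q₁) ≤ P(B ≥ q₂)` for all non-negative `q₁`, `q₂`
(no condition is imposed where `P(B ≥ q₁) = 0`). -/
def DecliningPatience : Prop :=
  ∀ q₁ q₂ : ℝ, 0 ≤ q₁ → 0 ≤ q₂ →
    ProbabilityTheory.cond M.budget (Set.Ici q₁) (Set.Ici (q₁ + q₂)) ≤ M.budget (Set.Ici q₂)

/-- The expected utility of a product does not increase with further exposures. -/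
def Burnout : Prop := ∀ i, Antitone (M.loc i)

/-- The joint law of the utility of the no-purchase option, the utilities of all exposures of all
products, and the patience budget: they are independent. -/
def law : Measure (ℝ × (Fin n × Fin w → ℝ) × ℝ) :=
  (gumbel 0).prod ((Measure.pi fun p : Fin n × Fin w => gumbel (M.loc p.1 p.2)).prod M.budget)

/-- Total patience cost of the products displayed in stage `z`. -/
def stageCost (x : Assortment n w m) (z : Fin m) : ℝ :=
  ∑ i, ∑ k, ((x i k z).toNat : ℝ) * M.cost i

/-- Total patience cost of an assortment. -/
def totalCost (x : Assortment n w m) : ℝ := ∑ z, M.stageCost x z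

/-- A consumer with no-purchase utility `u₀`, exposure utilities `u` and patience budget `b`
purchases product `i` in stage `t`: after each earlier stage she has found no product in it that
beats the no-purchase option and the patience cost of everything browsed so far is within her
budget; and in stage `t` product `i` beats the no-purchase option and has the largest utility
(ties have probability zero). -/
def Purchases (x : Assortment n w m) (u₀ : ℝ) (u : Fin n × Fin w → ℝ) (b : ℝ)
    (i : Fin n) (t : Fin m) : Prop :=
  (∀ s < t, (∀ j k, x j k s = true → u (j, k) ≤ u₀) ∧
      ∑ z ∈ Finset.Iic s, M.stageCost x z ≤ b) ∧
    ∃ k, x i k t = true ∧ u₀ < u (i, k) ∧ ∀ j l, x j l t = true → u (j, l) ≤ u (i, k)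

/-- Probability that the consumer purchases product `i` in stage `t`. -/
def choiceProb (x : Assortment n w m) (i : Fin n) (t : Fin m) : ℝ :=
  M.law.real {ω | M.Purchases x ω.1 ω.2.1 ω.2.2 i t}

/-- The expected revenue `f` of an assortment. -/
def expectedRevenue (x : Assortment n w m) : ℝ :=
  ∑ t, ∑ i, M.choiceProb x i t * M.rev i

/-- An optimal solution of the problem of maximizing the expected revenue over all feasible
assortments (`m` stages, capacity `d`). -/
def IsOptimal (d : ℕ) (x : Assortment n w m) : Prop :=
  Feasible d x ∧ ∀ y : Assortment n w m, Feasible d y → M.expectedRevenue y ≤ M.expectedRevenue x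

/-! ### The auxiliary problem: maximize `g` over the feasible assortments whose total patience cost
is within the budget with probability at least `ρ` -/

/-- The preference weight `β` of an exposure. -/
def weight (i : Fin n) (k : Fin w) : ℝ := Real.exp (M.loc i k)

/-- `γ = r β`. -/
def revWeight (i : Fin n) (k : Fin w) : ℝ := M.rev i * M.weight i k

/-- Total preference weight of stage `z`. -/
def stageWeight (x : Assortment n w m) (z : Fin m) : ℝ :=
  ∑ i, ∑ k, ((x i k z).toNat : ℝ) * M.weight i k

/-- The objective `g` of the auxiliary problem. -/
def patientRevenue (x : Assortment n w m) : ℝ :=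
  ∑ t, (∑ i, ∑ k, ((x i k t).toNat : ℝ) * M.revWeight i k) /
    ((1 + ∑ z ∈ Finset.Iio t, M.stageWeight x z) * (1 + ∑ z ∈ Finset.Iic t, M.stageWeight x z))

/-- The constraint of the auxiliary problem. -/
def WithinPatience (ρ : ℝ) (x : Assortment n w m) : Prop := ρ ≤ M.survival (M.totalCost x)

/-! ### The dynamic program for the auxiliary problem -/

/-- The geometric grid `{lo (1 + ε) ^ a ∣ a = 1, …, max 1 ⌈log_{1+ε} (d hi / (ε lo))⌉}`. -/
def grid (d : ℕ) (ε lo hi : ℝ) : Set ℝ :=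
  {s | ∃ a : ℕ, 1 ≤ a ∧ a ≤ max 1 ⌈Real.logb (1 + ε) (d * hi / (ε * lo))⌉₊ ∧
    s = lo * (1 + ε) ^ a}

/-- The guesses for the stage sums of `γ`. -/
def gridI (d : ℕ) (ε : ℝ) : Set ℝ :=
  grid d ε (⨅ p : Fin n × Fin w, M.revWeight p.1 p.2) (⨆ p : Fin n × Fin w, M.revWeight p.1 p.2)

/-- The guesses for the stage sums of `β`. -/
def gridJ (d : ℕ) (ε : ℝ) : Set ℝ :=
  grid d ε (⨅ p : Fin n × Fin w, M.weight p.1 p.2) (⨆ p : Fin n × Fin w, M.weight p.1 p.2)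

end Model

/-- The schedule of one product is the set `y` of the stages in which it is displayed; its
`(k+1)`-th exposure is displayed in the stage `z ∈ y` that is preceded by `k` elements of `y`. -/
def exposure {m : ℕ} (w : ℕ) (y : Finset (Fin m)) (k : Fin w) (z : Fin m) : Bool :=
  decide (z ∈ y ∧ (y.filter (· < z)).card = k.val)

/-- The assortment given by a schedule for each product. -/
def ofSchedules {n m : ℕ} (w : ℕ) (Y : Fin n → Finset (Fin m)) : Assortment n w m :=
  fun i => exposure w (Y i)

/-- The possible schedules of a product: at most `w` stages. -/
def schedules (w m : ℕ) : Finset (Finset (Fin m)) :=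
  Finset.univ.filter fun y => y.card ≤ w

/-- The indices `(u, v, l)` of the cells of the dynamic programming table. -/
abbrev Cell (m : ℕ) : Type := (Fin m → ℤ) × (Fin m → ℤ) × (Fin m → ℤ)

namespace Model

variable {n w m : ℕ} (M : Model n w)

/-- The contribution of the schedule `y` of product `i` to the index of a cell under the guess
`(μ, ν)`: in each stage, the value `⌈γ / (μ ε / d)⌉` and the value `⌊β / (ν ε / d)⌋` of the exposure
displayed there, and the number of exposures displayed there. -/
def contribution (d : ℕ) (ε : ℝ) (μ ν : Fin m → ℝ) (i : Fin n) (y : Finset (Fin m)) : Cell m :=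
  (fun z => ∑ k : Fin w, ((exposure w y k z).toNat : ℤ) * ⌈M.revWeight i k / (μ z * ε / d)⌉,
   fun z => ∑ k : Fin w, ((exposure w y k z).toNat : ℤ) * ⌊M.weight i k / (ν z * ε / d)⌋,
   fun z => ∑ k : Fin w, ((exposure w y k z).toNat : ℤ))

open Classical in
/-- The dynamic programming table: `table j s` is computed by recursion on the number `j` of
products considered, minimizing over the schedules of the last one of them; `⊤` is `+∞`. -/
def table (d : ℕ) (ε : ℝ) (μ ν : Fin m → ℝ) : ℕ → Cell m → WithTop ℝ
  | 0, s => if s = 0 then 0 else ⊤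
  | j + 1, s =>
    if hj : j < n then
      if 0 ≤ s then
        (schedules w m).inf fun y =>
          table d ε μ ν j (s - M.contribution d ε μ ν ⟨j, hj⟩ y) +
            (((y.card : ℝ) * M.cost ⟨j, hj⟩ : ℝ) : WithTop ℝ)
      else ⊤
    else ⊤

/-- The cell reached from cell `s` of the last row when the contributions of the schedules of all
products but the first `j` have been removed. -/
def remaining (d : ℕ) (ε : ℝ) (μ ν : Fin m → ℝ) (s : Cell m) (Y : Fin n → Finset (Fin m))
    (j : ℕ) : Cell m :=
  s - ∑ i ∈ Finset.univ.filter (fun i : Fin n => j ≤ i.val), M.contribution d ε μ ν i (Y i)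

/-- `Y` is obtained by tracing back the table from cell `s` of the last row: the schedule of each
product attains the minimum in the recursion. -/
def IsTraceback (d : ℕ) (ε : ℝ) (μ ν : Fin m → ℝ) (s : Cell m) (Y : Fin n → Finset (Fin m)) :
    Prop :=
  ∀ j : Fin n, Y j ∈ schedules w m ∧
    M.table d ε μ ν (j.val + 1) (M.remaining d ε μ ν s Y (j.val + 1)) =
      M.table d ε μ ν j.val (M.remaining d ε μ ν s Y j.val) +
        ((((Y j).card : ℝ) * M.cost j : ℝ) : WithTop ℝ)

/-- The guesses `(μ, ν)` and the cells `s = (u, v, l)` of the last row that are enumerated and hold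
a finite value. -/
def Enumerated (d : ℕ) (ε : ℝ) (μ ν : Fin m → ℝ) (s : Cell m) : Prop :=
  (∀ z, μ z ∈ M.gridI d ε) ∧ (∀ z, ν z ∈ M.gridJ d ε) ∧ 0 ≤ s ∧
    (∀ z, (s.1 z : ℝ) ≤ d * (d / ε + 1)) ∧ (∀ z, (s.2.1 z : ℝ) ≤ d * (d / ε + 1)) ∧
    (∀ z, s.2.2 z ≤ d) ∧ M.table d ε μ ν n s ≠ ⊤

/-- `x` is an assortment returned by the dynamic program: for each guess and each finite cell of the
last row one solution is traced back (`sol`, with ties in the minimum broken arbitrarily), and `x` is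
one of these solutions that satisfies the patience constraint and has the largest value of `g` among
the solutions that do. -/
def IsDPSolution (d : ℕ) (ρ ε : ℝ) (x : Assortment n w m) : Prop :=
  ∃ sol : (Fin m → ℝ) → (Fin m → ℝ) → Cell m → Fin n → Finset (Fin m),
    (∀ μ ν s, M.Enumerated d ε μ ν s → M.IsTraceback d ε μ ν s (sol μ ν s)) ∧
    M.WithinPatience ρ x ∧
    (∃ μ ν s, M.Enumerated d ε μ ν s ∧ x = ofSchedules w (sol μ ν s)) ∧
    ∀ μ ν s, M.Enumerated d ε μ ν s → M.WithinPatience ρ (ofSchedules w (sol μ ν s)) →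
      M.patientRevenue (ofSchedules w (sol μ ν s)) ≤ M.patientRevenue x

/-- `x` is an output of ACME with parameters `ρ` and `ε`: the better one, in terms of expected
revenue, of a solution `x'` returned by the dynamic program and an optimal solution `x''` of the
one-stage problem. -/
def IsACMEOutput (d : ℕ) (ρ ε : ℝ) (x : Assortment n w m) : Prop :=
  ∃ (x' : Assortment n w m) (x'' : Assortment n w 1),
    M.IsDPSolution d ρ ε x' ∧ M.IsOptimal d x'' ∧
    ((x = x' ∧ M.expectedRevenue (inFirstStage m x'') ≤ M.expectedRevenue x') ∨
      (x = inFirstStage m x'' ∧ M.expectedRevenue x' ≤ M.expectedRevenue (inFirstStage m x'')))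

end Model

end Cascade

end

noncomputable section

namespace Cascade

/-! ### Gumbel distributions -/

section Gumbel

open Filter Topology

/-! Closed form of the revenue. A maximum of independent Gumbel variables is Gumbel, with preference
weights added. Hence, if `S` is the set of exposures seen before stage `t` and `T` that of stage
`t`, with total weights `V_S` and `V_T`, an exposure of weight `β` in `T` is chosen with probability
`β / ((1 + V_S)(1 + V_S + V_T))`, times the independent probability that patience lasts until `t`.
So `f = ∑ F(C_t) R_t` and `g = ∑ R_t`, where `C_t` is the cost of the stages before `t` and `R_t` is
`stageRevenue` (`expectedRevenue_eq`). By burnout, deleting other stages does not decrease `R_t`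
(`stageRevenue_le`).

Upper bound on the optimum `V` (`exists_decomposition`). Let `s` be the largest number of initial
stages of an optimal assortment whose cost is within patience with probability at least `ρ`. These
stages form a candidate `Y₁` for the auxiliary problem and earn at most `g(Y₁)`. The next stage
earns at most the one-stage optimum `f(x'')`. For the rest, the cost already incurred has survival
below `ρ`; since `F(q₁ + q₂) ≤ F(q₁) F(q₂)`, they earn at most `ρ` times what they would earn if
displayed from the start, hence at most `ρ V`. Therefore `(1 - ρ) V ≤ g(Y₁) + f(x'')`.

Lower bound on the output. Put `η = ε(1 + ε)` and `κ = (1 - η)/(1 + η)²`. For guesses within a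
factor `1 + ε` of the stage sums of `Y₁`, the traceback from the cell of `Y₁` has the same rounded
sums and costs no more. It therefore satisfies the patience constraint, and rounding changes each
stage sum by a relative error of at most `η`. This gives `g(x') ≥ κ g(Y₁)`
(`IsDPSolution.patientRevenue_ge`). The patience constraint gives `f(x') ≥ ρ g(x')`. Together, `ρκ(1
- ρ) V ≤ f(x') + ρκ f(x'')`, at most twice the revenue of the output. -/

theorem setLIntegral_Ioi_of_hasDerivAt_of_nonneg {g g' : ℝ → ℝ} {l : ℝ} (a : ℝ)
    (hg : ∀ x, HasDerivAt g (g' x) x) (hg' : ∀ x, 0 ≤ g' x) (hl : Tendsto g atTop (𝓝 l)) :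
    ∫⁻ x in Set.Ioi a, ENNReal.ofReal (g' x) = ENNReal.ofReal (l - g a) := by
  rw [← integral_Ioi_of_hasDerivAt_of_nonneg' (fun x _ => hg x) (fun x _ => hg' x) hl,
    ofReal_integral_eq_lintegral_ofReal]
  · exact integrableOn_Ioi_deriv_of_nonneg' (fun x _ => hg x) (fun x _ => hg' x) hl
  · exact Eventually.of_forall hg'

/-- Exhaust the line by the half-lines `Set.Ioi a` as `a → -∞`. -/
theorem lintegral_of_hasDerivAt_of_nonneg {g g' : ℝ → ℝ} {k l : ℝ}
    (hg : ∀ x, HasDerivAt g (g' x) x) (hg' : ∀ x, 0 ≤ g' x)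
    (hm : Measurable g') (hk : Tendsto g atBot (𝓝 k)) (hl : Tendsto g atTop (𝓝 l)) :
    ∫⁻ x, ENNReal.ofReal (g' x) = ENNReal.ofReal (l - k) := by
  have h := (aecover_Ioi (μ := volume) (l := (atBot : Filter ℝ)) (a := id)
    tendsto_id).lintegral_tendsto_of_countably_generated
    (f := fun x => ENNReal.ofReal (g' x)) hm.ennreal_ofReal.aemeasurable
  refine tendsto_nhds_unique h ?_
  simp_rw [id, setLIntegral_Ioi_of_hasDerivAt_of_nonneg _ hg hg' hl]
  exact ENNReal.tendsto_ofReal (tendsto_const_nhds.sub hk)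

/-- The distribution function of the Gumbel distribution with preference weight `c`. -/
def gumbelCDF (c s : ℝ) : ℝ := Real.exp (-(c * Real.exp (-s)))

theorem gumbelCDF_nonneg (c s : ℝ) : 0 ≤ gumbelCDF c s := (Real.exp_pos _).le

/-- Distribution functions of independent maxima multiply, so weights add. This is why the weight,
not the location, is the parameter; weight `0` stands for the maximum over an empty set. -/
theorem gumbelCDF_add (b c s : ℝ) : gumbelCDF (b + c) s = gumbelCDF b s * gumbelCDF c s := by
  simp only [gumbelCDF, ← Real.exp_add]; congr 1; ring

theorem gumbelCDF_le_one {c : ℝ} (hc : 0 ≤ c) (s : ℝ) : gumbelCDF c s ≤ 1 := by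
  rw [gumbelCDF, Real.exp_le_one_iff]
  have := Real.exp_pos (-s)
  nlinarith [mul_nonneg hc this.le]

theorem measurable_gumbelCDF (c : ℝ) : Measurable (gumbelCDF c) := by
  unfold gumbelCDF; fun_prop

theorem hasDerivAt_gumbelCDF (c s : ℝ) :
    HasDerivAt (gumbelCDF c) (c * Real.exp (-s) * gumbelCDF c s) s := by
  have h1 : HasDerivAt (fun s : ℝ => Real.exp (-s)) (-Real.exp (-s)) s := by
    simpa using (hasDerivAt_neg s).exp
  have h2 := ((h1.const_mul c).neg).exp
  have h3 : Real.exp (-(c * Real.exp (-s))) * -(c * -Real.exp (-s)) =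
      c * Real.exp (-s) * gumbelCDF c s := by
    rw [gumbelCDF]; ring
  exact h3 ▸ h2

theorem tendsto_gumbelCDF_atTop (c : ℝ) : Tendsto (gumbelCDF c) atTop (𝓝 1) := by
  have h : Tendsto (fun s : ℝ => -(c * Real.exp (-s))) atTop (𝓝 (-(c * 0))) :=
    ((Real.tendsto_exp_neg_atTop_nhds_zero).const_mul c).neg
  rw [mul_zero, neg_zero] at h
  exact Real.exp_zero ▸ (Real.continuous_exp.tendsto 0).comp h

theorem tendsto_gumbelCDF_atBot {c : ℝ} (hc : 0 < c) : Tendsto (gumbelCDF c) atBot (𝓝 0) := by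
  have h : Tendsto (fun s : ℝ => c * Real.exp (-s)) atBot atTop :=
    (Real.tendsto_exp_atTop.comp tendsto_neg_atBot_atTop).const_mul_atTop hc
  exact Real.tendsto_exp_neg_atTop_nhds_zero.comp h

/-- Puts the density in the form of the derivative in `hasDerivAt_gumbelCDF`, so that every integral
below comes from an explicit antiderivative. -/
theorem gumbel_eq (a : ℝ) : gumbel a = volume.withDensity fun s =>
    ENNReal.ofReal (Real.exp a * Real.exp (-s) * gumbelCDF (Real.exp a) s) := by
  unfold gumbel
  congr 1
  ext s
  simp only [gumbelCDF, ← Real.exp_add]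
  rw [show -(s - a) = a + -s by ring]

theorem lintegral_gumbel (a : ℝ) {f : ℝ → ENNReal} (hf : Measurable f) :
    ∫⁻ s, f s ∂gumbel a = ∫⁻ s,
      ENNReal.ofReal (Real.exp a * Real.exp (-s) * gumbelCDF (Real.exp a) s) * f s := by
  have hm : Measurable fun s =>
      ENNReal.ofReal (Real.exp a * Real.exp (-s) * gumbelCDF (Real.exp a) s) := by
    have := measurable_gumbelCDF (Real.exp a)
    fun_prop
  rw [gumbel_eq, lintegral_withDensity_eq_lintegral_mul _ hm hf]
  rfl

theorem gumbel_density_nonneg (a s : ℝ) :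
    0 ≤ Real.exp a * Real.exp (-s) * gumbelCDF (Real.exp a) s :=
  mul_nonneg (by positivity) (gumbelCDF_nonneg _ _)

instance (a : ℝ) : IsProbabilityMeasure (gumbel a) := by
  constructor
  have h := lintegral_gumbel a (f := fun _ => 1) measurable_const
  simp only [lintegral_const, one_mul, mul_one] at h
  have hm : Measurable fun s => Real.exp a * Real.exp (-s) * gumbelCDF (Real.exp a) s := by
    have := measurable_gumbelCDF (Real.exp a)
    fun_prop
  rw [h, lintegral_of_hasDerivAt_of_nonneg (hasDerivAt_gumbelCDF _) (gumbel_density_nonneg a) hm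
    (tendsto_gumbelCDF_atBot (Real.exp_pos a)) (tendsto_gumbelCDF_atTop _)]
  simp

theorem gumbel_Ioi (a t : ℝ) :
    gumbel a (Set.Ioi t) = ENNReal.ofReal (1 - gumbelCDF (Real.exp a) t) := by
  rw [gumbel_eq, withDensity_apply _ measurableSet_Ioi]
  exact setLIntegral_Ioi_of_hasDerivAt_of_nonneg t (hasDerivAt_gumbelCDF _)
    (gumbel_density_nonneg a) (tendsto_gumbelCDF_atTop _)

theorem gumbel_Iic (a t : ℝ) :
    gumbel a (Set.Iic t) = ENNReal.ofReal (gumbelCDF (Real.exp a) t) := by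
  rw [← Set.compl_Ioi, prob_compl_eq_one_sub measurableSet_Ioi, gumbel_Ioi,
    ← ENNReal.ofReal_one, ← ENNReal.ofReal_sub]
  · simp
  · linarith [gumbelCDF_le_one (Real.exp_pos a).le t]

/-! ### Choice among independent Gumbel utilities -/

variable {ι : Type*}

theorem measurableSet_forall_mem_le [Countable ι] (S : Finset ι) {α : Type*} [MeasurableSpace α]
    {f : ι → α → ℝ} {g : α → ℝ} (hf : ∀ i, Measurable (f i)) (hg : Measurable g) :
    MeasurableSet {u | ∀ p ∈ S, f p u ≤ g u} := by
  simp only [Set.ofPred_forall]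
  exact MeasurableSet.iInter fun p => MeasurableSet.iInter fun _ => measurableSet_le (hf p) hg

/-- The utilities for which the elements of `S` do not beat the utility `c` of the no-purchase
option, `q` beats it, and `q` has the largest utility in `T`. -/
def choiceSet (S T : Finset ι) (q : ι) (c : ℝ) : Set (ι → ℝ) :=
  {u | (∀ p ∈ S, u p ≤ c) ∧ c < u q ∧ ∀ p ∈ T, u p ≤ u q}

theorem measurableSet_choiceSet [Countable ι] (S T : Finset ι) (q : ι) :
    MeasurableSet {ω : ℝ × (ι → ℝ) | ω.2 ∈ choiceSet S T q ω.1} := by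
  have h1 := measurableSet_forall_mem_le S (f := fun i (ω : ℝ × (ι → ℝ)) => ω.2 i)
    (g := fun ω => ω.1) (fun i => by fun_prop) (by fun_prop)
  have h2 := measurableSet_forall_mem_le T (f := fun i (ω : ℝ × (ι → ℝ)) => ω.2 i)
    (g := fun ω => ω.2 q) (fun i => by fun_prop) (by fun_prop)
  have h3 : MeasurableSet {ω : ℝ × (ι → ℝ) | ω.1 < ω.2 q} :=
    measurableSet_lt (by fun_prop) (by fun_prop)
  exact h1.inter (h3.inter h2)

variable [Fintype ι] [DecidableEq ι]

/-- Once the utility of `q` is fixed at `v`, the choice event constrains each other utility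
separately: below `c` on `S`, below `v` on `T`, not at all elsewhere. -/
theorem prod_gumbel_Iic (a : ι → ℝ) {S T : Finset ι} (hST : Disjoint S T) {q : ι} (hq : q ∈ T)
    (c v : ℝ) :
    ∏ p ∈ Finset.univ.erase q,
        gumbel (a p) (if p ∈ S then Set.Iic c else if p ∈ T then Set.Iic v else Set.univ) =
      ENNReal.ofReal (gumbelCDF (∑ p ∈ S, Real.exp (a p)) c *
        gumbelCDF (∑ p ∈ T, Real.exp (a p) - Real.exp (a q)) v) := by
  have h : ∀ p, gumbel (a p)
      (if p ∈ S then Set.Iic c else if p ∈ T then Set.Iic v else Set.univ) =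
      ENNReal.ofReal (Real.exp (-((if p ∈ S then Real.exp (a p) else 0) * Real.exp (-c)
        + (if p ∈ T then Real.exp (a p) else 0) * Real.exp (-v)))) := by
    intro p
    by_cases hS : p ∈ S
    · have hT : p ∉ T := Finset.disjoint_left.1 hST hS
      simp [hS, hT, gumbel_Iic, gumbelCDF]
    · by_cases hT : p ∈ T
      · simp [hS, hT, gumbel_Iic, gumbelCDF]
      · simp [hS, hT]
  simp_rw [h]
  rw [← ENNReal.ofReal_prod_of_nonneg (fun _ _ => (Real.exp_pos _).le), ← Real.exp_sum]
  simp only [gumbelCDF, ← Real.exp_add]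
  congr 2
  have hqS : q ∉ S := Finset.disjoint_right.1 hST hq
  rw [Finset.sum_erase_eq_sub (Finset.mem_univ q), Finset.sum_neg_distrib, Finset.sum_add_distrib,
    ← Finset.sum_mul, ← Finset.sum_mul]
  simp only [Finset.sum_ite_mem, Finset.univ_inter, hq, hqS, if_true, if_false]
  ring

theorem pi_gumbel_choiceSet (a : ι → ℝ) {S T : Finset ι} (hST : Disjoint S T) {q : ι} (hq : q ∈ T)
    (c : ℝ) :
    Measure.pi (fun p => gumbel (a p)) (choiceSet S T q c) =
      ENNReal.ofReal (gumbelCDF (∑ p ∈ S, Real.exp (a p)) c *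
        (Real.exp (a q) / ∑ p ∈ T, Real.exp (a p)) *
          (1 - gumbelCDF (∑ p ∈ T, Real.exp (a p)) c)) := by
  have hA : MeasurableSet (choiceSet S T q c) :=
    (measurable_prodMk_left (x := c)) (measurableSet_choiceSet S T q)
  have hVT : 0 < ∑ p ∈ T, Real.exp (a p) := Finset.sum_pos (fun _ _ => Real.exp_pos _) ⟨q, hq⟩
  have hqS : q ∉ S := Finset.disjoint_right.1 hST hq
  set VS := ∑ p ∈ S, Real.exp (a p) with hVSdef
  set VT := ∑ p ∈ T, Real.exp (a p) with hVTdef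
  -- Integrate out all coordinates but `q`; for a fixed value `v` of that coordinate, the choice set
  -- is a box if `c < v` and empty otherwise.
  have hinner : ∀ v : ℝ, (∫⋯∫⁻_Finset.univ.erase q, (choiceSet S T q c).indicator 1
      ∂fun p => gumbel (a p)) (Function.update (0 : ι → ℝ) q v) =
      (Set.Ioi c).indicator
        (fun v => ENNReal.ofReal (gumbelCDF VS c * gumbelCDF (VT - Real.exp (a q)) v)) v := by
    intro v
    have hset : {y : (i : ↥(Finset.univ.erase q)) → ℝ |
        Function.updateFinset (Function.update (0 : ι → ℝ) q v) (Finset.univ.erase q) y ∈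
          choiceSet S T q c} = if c < v then Set.univ.pi fun p : ↥(Finset.univ.erase q) =>
            (if p.1 ∈ S then Set.Iic c else if p.1 ∈ T then Set.Iic v else Set.univ) else ∅ := by
      ext y
      have hval : ∀ p, Function.updateFinset (Function.update (0 : ι → ℝ) q v)
          (Finset.univ.erase q) y p =
          if h : p ∈ Finset.univ.erase q then y ⟨p, h⟩ else v := by
        intro p
        rw [Function.updateFinset]
        split_ifs with h
        · rfl
        · have : p = q := by simpa using h
          subst this; simp
      have hvq : Function.updateFinset (Function.update (0 : ι → ℝ) q v)
          (Finset.univ.erase q) y q = v := by rw [hval, dif_neg (by simp)]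
      simp only [choiceSet, Set.mem_ofPred_eq, hvq]
      split_ifs with hcv
      · simp only [Set.mem_pi, Set.mem_univ, true_implies, hcv, true_and]
        constructor
        · rintro ⟨h1, h2⟩ ⟨p, hp⟩
          split_ifs with hS hT
          · have := h1 p hS
            rwa [hval, dif_pos hp] at this
          · have := h2 p hT
            rwa [hval, dif_pos hp] at this
          · trivial
        · intro h
          refine ⟨fun p hS => ?_, fun p hT => ?_⟩
          · have hp : p ∈ Finset.univ.erase q := by
              simp only [Finset.mem_erase, Finset.mem_univ, and_true]
              rintro rfl; exact hqS hS
            have := h ⟨p, hp⟩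
            rw [if_pos hS] at this
            rw [hval, dif_pos hp]; exact this
          · rw [hval]
            split_ifs with hp
            · have := h ⟨p, hp⟩
              rw [if_neg (Finset.disjoint_right.1 hST hT), if_pos hT] at this
              exact this
            · exact le_rfl
      · simp [hcv]
    have hmeas : MeasurableSet {y : (i : ↥(Finset.univ.erase q)) → ℝ |
        Function.updateFinset (Function.update (0 : ι → ℝ) q v) (Finset.univ.erase q) y ∈
          choiceSet S T q c} := measurable_updateFinset hA
    rw [lmarginal]
    have : ∀ y : (i : ↥(Finset.univ.erase q)) → ℝ, (choiceSet S T q c).indicator (1 : (ι → ℝ) → ENNReal)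
        (Function.updateFinset (Function.update (0 : ι → ℝ) q v) (Finset.univ.erase q) y) =
        Set.indicator {y : (i : ↥(Finset.univ.erase q)) → ℝ |
        Function.updateFinset (Function.update (0 : ι → ℝ) q v) (Finset.univ.erase q) y ∈
          choiceSet S T q c} 1 y := fun y => rfl
    simp_rw [this]
    rw [lintegral_indicator_one hmeas, hset]
    by_cases hcv : c < v
    · rw [if_pos hcv, Measure.pi_pi, Set.indicator_of_mem (show v ∈ Set.Ioi c from hcv),
        ← prod_gumbel_Iic a hST hq]
      exact Finset.prod_coe_sort (Finset.univ.erase q) fun p => gumbel (a p)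
        (if p ∈ S then Set.Iic c else if p ∈ T then Set.Iic v else Set.univ)
    · rw [if_neg hcv, measure_empty, Set.indicator_of_notMem (show v ∉ Set.Ioi c from hcv)]
  rw [← lintegral_indicator_one hA, lintegral_eq_lmarginal_univ 0,
    lmarginal_erase _ (measurable_one.indicator hA) (Finset.mem_univ q)]
  simp_rw [hinner]
  have hm : Measurable fun v =>
      ENNReal.ofReal (gumbelCDF VS c * gumbelCDF (VT - Real.exp (a q)) v) := by
    have := measurable_gumbelCDF (VT - Real.exp (a q))
    fun_prop
  rw [lintegral_gumbel _ (hm.indicator measurableSet_Ioi)]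
  -- The density of `q` times the distribution function of the rest of `T` is a constant multiple of
  -- the derivative of `gumbelCDF VT`.
  have : ∀ s, ENNReal.ofReal (Real.exp (a q) * Real.exp (-s) * gumbelCDF (Real.exp (a q)) s) *
      (Set.Ioi c).indicator (fun v =>
        ENNReal.ofReal (gumbelCDF VS c * gumbelCDF (VT - Real.exp (a q)) v)) s =
      (Set.Ioi c).indicator (fun s => ENNReal.ofReal
        (gumbelCDF VS c * (Real.exp (a q) / VT) * (VT * Real.exp (-s) * gumbelCDF VT s))) s := by
    intro s
    by_cases hs : s ∈ Set.Ioi c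
    · rw [Set.indicator_of_mem hs, Set.indicator_of_mem hs,
        ← ENNReal.ofReal_mul (gumbel_density_nonneg _ _)]
      congr 1
      have h1 := gumbelCDF_add (Real.exp (a q)) (VT - Real.exp (a q)) s
      rw [add_sub_cancel] at h1
      rw [h1]
      field_simp
    · rw [Set.indicator_of_notMem hs, Set.indicator_of_notMem hs, mul_zero]
  simp_rw [this]
  rw [lintegral_indicator measurableSet_Ioi,
    setLIntegral_Ioi_of_hasDerivAt_of_nonneg (l := gumbelCDF VS c * (Real.exp (a q) / VT) * 1) c
      (fun x => (hasDerivAt_gumbelCDF VT x).const_mul (gumbelCDF VS c * (Real.exp (a q) / VT)))]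
  · congr 1; ring
  · intro x
    have := gumbelCDF_nonneg VS c
    have := gumbelCDF_nonneg VT x
    positivity
  · exact (tendsto_gumbelCDF_atTop _).const_mul _

/-- The no-purchase option has weight `1`, so the integrand is a combination of Gumbel densities of
weights `1 + VS` and `1 + VS + VT`. The integral is `exp (a q) / VT` times the difference of the
reciprocals of these weights. -/
theorem lintegral_gumbel_choiceSet (a : ι → ℝ) {S T : Finset ι} (hST : Disjoint S T) {q : ι}
    (hq : q ∈ T) :
    ∫⁻ c, Measure.pi (fun p => gumbel (a p)) (choiceSet S T q c) ∂gumbel 0 =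
      ENNReal.ofReal (Real.exp (a q) / ((1 + ∑ p ∈ S, Real.exp (a p)) *
        (1 + (∑ p ∈ S, Real.exp (a p) + ∑ p ∈ T, Real.exp (a p))))) := by
  have hVT : 0 < ∑ p ∈ T, Real.exp (a p) := Finset.sum_pos (fun _ _ => Real.exp_pos _) ⟨q, hq⟩
  have hVS : 0 ≤ ∑ p ∈ S, Real.exp (a p) := Finset.sum_nonneg (fun _ _ => (Real.exp_pos _).le)
  simp_rw [pi_gumbel_choiceSet a hST hq]
  set VS := ∑ p ∈ S, Real.exp (a p)
  set VT := ∑ p ∈ T, Real.exp (a p)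
  have hm1 := measurable_gumbelCDF VS
  have hm2 := measurable_gumbelCDF VT
  rw [lintegral_gumbel _ (by fun_prop)]
  set κ := Real.exp (a q) / VT with hκ
  have hκ0 : 0 ≤ κ := by positivity
  have h : ∀ s, ENNReal.ofReal (Real.exp 0 * Real.exp (-s) * gumbelCDF (Real.exp 0) s) *
      ENNReal.ofReal (gumbelCDF VS s * κ * (1 - gumbelCDF VT s)) =
      ENNReal.ofReal (κ * ((1 + VS)⁻¹ * ((1 + VS) * Real.exp (-s) * gumbelCDF (1 + VS) s) -
        (1 + (VS + VT))⁻¹ * ((1 + (VS + VT)) * Real.exp (-s) * gumbelCDF (1 + (VS + VT)) s))) := by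
    intro s
    rw [← ENNReal.ofReal_mul (gumbel_density_nonneg _ _), gumbelCDF_add 1 (VS + VT),
      gumbelCDF_add VS VT, gumbelCDF_add 1 VS, Real.exp_zero]
    congr 1
    field_simp
  simp_rw [h]
  rw [lintegral_of_hasDerivAt_of_nonneg (k := κ * ((1 + VS)⁻¹ * 0 - (1 + (VS + VT))⁻¹ * 0))
    (l := κ * ((1 + VS)⁻¹ * 1 - (1 + (VS + VT))⁻¹ * 1))
    (fun x => (((hasDerivAt_gumbelCDF (1 + VS) x).const_mul (1 + VS)⁻¹).sub
      ((hasDerivAt_gumbelCDF (1 + (VS + VT)) x).const_mul (1 + (VS + VT))⁻¹)).const_mul κ)]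
  · congr 1
    rw [hκ]
    field_simp
    ring
  · intro x
    have h0 : 0 < 1 + VS := by positivity
    have h1 : 0 < 1 + (VS + VT) := by positivity
    rw [mul_assoc (1 + VS), inv_mul_cancel_left₀ h0.ne', mul_assoc (1 + (VS + VT)),
      inv_mul_cancel_left₀ h1.ne', ← mul_sub]
    refine mul_nonneg hκ0 (mul_nonneg (Real.exp_pos _).le ?_)
    rw [← add_assoc, gumbelCDF_add (1 + VS) VT]
    nlinarith [gumbelCDF_nonneg (1 + VS) x, gumbelCDF_le_one hVT.le x]
  · have hm3 := measurable_gumbelCDF (1 + VS)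
    have hm4 := measurable_gumbelCDF (1 + (VS + VT))
    fun_prop
  · exact ((((tendsto_gumbelCDF_atBot (by positivity)).const_mul _).sub
      ((tendsto_gumbelCDF_atBot (by positivity)).const_mul _)).const_mul κ)
  · exact ((((tendsto_gumbelCDF_atTop _).const_mul _).sub
      ((tendsto_gumbelCDF_atTop _).const_mul _)).const_mul κ)

end Gumbel

/-! ### Schedules -/

section Schedules

variable {m w : ℕ}

/-- The number of elements of `y` below `z`. -/
def rank (y : Finset (Fin m)) (z : Fin m) : ℕ := (y.filter (· < z)).card

theorem rank_lt_card {y : Finset (Fin m)} {z : Fin m} (hz : z ∈ y) : rank y z < y.card :=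
  Finset.card_lt_card (Finset.filter_ssubset.2 ⟨z, hz, lt_irrefl z⟩)

theorem rank_lt_rank {y : Finset (Fin m)} {z z' : Fin m} (hz : z ∈ y) (h : z < z') :
    rank y z < rank y z' := by
  refine Finset.card_lt_card ⟨fun a ha => ?_, fun hsub => ?_⟩
  · simp only [Finset.mem_filter] at ha ⊢
    exact ⟨ha.1, ha.2.trans h⟩
  · have := hsub (Finset.mem_filter.2 ⟨hz, h⟩)
    simp at this

theorem rank_injOn (y : Finset (Fin m)) : Set.InjOn (rank y) y := by
  intro a ha b hb hab
  rcases lt_trichotomy a b with h | h | h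
  · exact absurd hab (rank_lt_rank ha h).ne
  · exact h
  · exact absurd hab (rank_lt_rank hb h).ne'

theorem image_rank (y : Finset (Fin m)) : y.image (rank y) = Finset.range y.card := by
  refine Finset.eq_of_subset_of_card_le (fun k hk => ?_) ?_
  · obtain ⟨z, hz, rfl⟩ := Finset.mem_image.1 hk
    exact Finset.mem_range.2 (rank_lt_card hz)
  · rw [Finset.card_image_of_injOn (rank_injOn y), Finset.card_range]

theorem exists_rank_eq {y : Finset (Fin m)} {k : ℕ} (hk : k < y.card) : ∃ z ∈ y, rank y z = k := by
  have : k ∈ y.image (rank y) := by rw [image_rank]; exact Finset.mem_range.2 hk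
  simpa using this

theorem rank_inter {L : Finset (Fin m)} (hL : IsLowerSet (L : Set (Fin m))) (y : Finset (Fin m))
    {z : Fin m} (hz : z ∈ L) : rank (y ∩ L) z = rank y z := by
  unfold rank
  congr 1
  ext a
  simp only [Finset.mem_filter, Finset.mem_inter]
  exact ⟨fun h => ⟨h.1.1, h.2⟩, fun h => ⟨⟨h.1, hL h.2.le hz⟩, h.2⟩⟩

theorem rank_eq_card_inter (y : Finset (Fin m)) (z : Fin m) :
    rank y z = (y ∩ Finset.Iio z).card := by
  unfold rank
  congr 1
  ext a
  simp

theorem card_inter_Iic (y : Finset (Fin m)) (z : Fin m) :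
    (y ∩ Finset.Iic z).card = rank y z + if z ∈ y then 1 else 0 := by
  rw [rank_eq_card_inter]
  split_ifs with h
  · rw [← Finset.card_insert_of_notMem (a := z) (by simp)]
    congr 1
    ext a
    simp only [Finset.mem_inter, Finset.mem_Iic, Finset.mem_insert, Finset.mem_Iio, le_iff_lt_or_eq]
    constructor
    · rintro ⟨h1, h2 | h2⟩
      · exact Or.inr ⟨h1, h2⟩
      · exact Or.inl h2
    · rintro (rfl | h1)
      · exact ⟨h, Or.inr rfl⟩
      · exact ⟨h1.1, Or.inl h1.2⟩
  · rw [add_zero]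
    congr 1
    ext a
    simp only [Finset.mem_inter, Finset.mem_Iic, Finset.mem_Iio]
    refine ⟨fun ⟨h1, h2⟩ => ⟨h1, lt_of_le_of_ne h2 ?_⟩, fun ⟨h1, h2⟩ => ⟨h1, h2.le⟩⟩
    rintro rfl
    exact h h1

theorem isLowerSet_Iic (t : Fin m) : IsLowerSet ((Finset.Iic t : Finset (Fin m)) : Set (Fin m)) := by
  rw [Finset.coe_Iic]; exact _root_.isLowerSet_Iic t

theorem isLowerSet_Iio (t : Fin m) : IsLowerSet ((Finset.Iio t : Finset (Fin m)) : Set (Fin m)) := by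
  rw [Finset.coe_Iio]; exact _root_.isLowerSet_Iio t

theorem exposure_iff {y : Finset (Fin m)} {k : Fin w} {z : Fin m} :
    exposure w y k z = true ↔ z ∈ y ∧ rank y z = k := by
  simp [exposure, rank]

/-- The stages of `y` in a lower set have ranks `0, …, (y ∩ L).card - 1`. Thus what has been seen by
a given stage depends only on how often each product has been displayed. -/
theorem exists_exposure_iff {L : Finset (Fin m)} (hL : IsLowerSet (L : Set (Fin m)))
    {y : Finset (Fin m)} {k : Fin w} :
    (∃ z ∈ L, exposure w y k z = true) ↔ k.val < (y ∩ L).card := by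
  constructor
  · rintro ⟨z, hz, h⟩
    obtain ⟨h1, h2⟩ := exposure_iff.1 h
    rw [← h2, ← rank_inter hL y hz]
    exact rank_lt_card (Finset.mem_inter.2 ⟨h1, hz⟩)
  · intro h
    obtain ⟨z, hz, hk⟩ := exists_rank_eq h
    have hz' := Finset.mem_inter.1 hz
    rw [rank_inter hL y hz'.2] at hk
    exact ⟨z, hz'.2, exposure_iff.2 ⟨hz'.1, hk⟩⟩

theorem sum_exposure {L : Finset (Fin m)} (hL : IsLowerSet (L : Set (Fin m)))
    (y : Finset (Fin m)) (k : Fin w) :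
    ∑ z ∈ L, (exposure w y k z).toNat = if k.val < (y ∩ L).card then 1 else 0 := by
  split_ifs with h
  · obtain ⟨z, hz, hk⟩ := (exists_exposure_iff hL).2 h
    rw [Finset.sum_eq_single_of_mem z hz, hk]
    · rfl
    · intro b _ hbz
      rw [Bool.toNat_eq_zero, Bool.eq_false_iff]
      intro hb
      have h1 := exposure_iff.1 hk
      have h2 := exposure_iff.1 hb
      exact hbz (rank_injOn y h2.1 h1.1 (h2.2.trans h1.2.symm))
  · refine Finset.sum_eq_zero fun z hz => ?_
    rw [Bool.toNat_eq_zero, Bool.eq_false_iff]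
    exact fun hb => h ((exists_exposure_iff hL).1 ⟨z, hz, hb⟩)

theorem sum_sum_exposure_mul {L : Finset (Fin m)} (hL : IsLowerSet (L : Set (Fin m)))
    (y : Finset (Fin m)) (a : Fin w → ℝ) :
    ∑ z ∈ L, ∑ k, ((exposure w y k z).toNat : ℝ) * a k =
      ∑ k : Fin w, if k.val < (y ∩ L).card then a k else 0 := by
  rw [Finset.sum_comm]
  refine Finset.sum_congr rfl fun k _ => ?_
  rw [← Finset.sum_mul, ← Nat.cast_sum, sum_exposure hL]
  split_ifs <;> simp

theorem sum_exposure_mul_of_mem {R : Type*} [Semiring R] {y : Finset (Fin m)} (hy : y.card ≤ w)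
    {z : Fin m} (hz : z ∈ y) (a : Fin w → R) :
    ∑ k, ((exposure w y k z).toNat : R) * a k = a ⟨rank y z, (rank_lt_card hz).trans_le hy⟩ := by
  rw [Finset.sum_eq_single ⟨rank y z, (rank_lt_card hz).trans_le hy⟩]
  · rw [exposure_iff.2 ⟨hz, rfl⟩]; simp
  · intro k _ hk
    have : exposure w y k z = false := by
      rw [Bool.eq_false_iff]
      intro h
      exact hk (Fin.ext (exposure_iff.1 h).2.symm)
    simp [this]
  · simp

theorem exposure_of_notMem {y : Finset (Fin m)} {z : Fin m} (hz : z ∉ y) (k : Fin w) :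
    exposure w y k z = false := by
  rw [Bool.eq_false_iff]
  exact fun h => hz (exposure_iff.1 h).1

theorem sum_exposure_stage {y : Finset (Fin m)} (hy : y.card ≤ w) (z : Fin m) :
    ∑ k : Fin w, (exposure w y k z).toNat = if z ∈ y then 1 else 0 := by
  split_ifs with hz
  · simpa using sum_exposure_mul_of_mem (R := ℕ) hy hz fun _ => 1
  · simp [exposure_of_notMem hz]

variable {n d : ℕ}

/-- Schedules that yield a feasible assortment. -/
structure Admissible (w d : ℕ) (Y : Fin n → Finset (Fin m)) : Prop where
  card_le : ∀ i, (Y i).card ≤ w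
  capacity : ∀ z, ∑ i, (if z ∈ Y i then 1 else 0) ≤ d

theorem Admissible.feasible {Y : Fin n → Finset (Fin m)} (hY : Admissible w d Y) :
    Feasible d (ofSchedules w Y) where
  once z i := by
    rw [show ∑ k, (ofSchedules w Y i k z).toNat = _ from sum_exposure_stage (hY.card_le i) z]
    split_ifs <;> simp
  order i s z := by
    by_cases h : exposure w (Y i) s z = true
    · congr 1
      obtain ⟨h1, h2⟩ := exposure_iff.1 h
      rw [Finset.sum_comm]
      have hcard : (Y i ∩ Finset.Iic z).card = s.val + 1 := by
        rw [card_inter_Iic, if_pos h1, h2]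
      simp only [ofSchedules, sum_exposure (isLowerSet_Iic z), hcard]
      rw [Finset.sum_congr rfl (g := fun _ => 1)]
      · simp
      · intro k hk
        have : k ≤ s := Finset.mem_Iic.1 hk
        rw [if_pos (Nat.lt_succ_of_le this)]
    · have : ofSchedules w Y i s z = false := by
        rw [Bool.eq_false_iff]; exact h
      simp [this]
  capacity z := by
    refine le_trans (le_of_eq (Finset.sum_congr rfl fun i _ => ?_)) (hY.capacity z)
    exact sum_exposure_stage (hY.card_le i) z

/-- The order constraint forces exposures to be numbered by rank. Strong induction on the stage:
once earlier exposures follow the ranks, the constraint at `z` determines the number of earlier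
displays. Hence feasible assortments are exactly those given by admissible schedules. -/
theorem Feasible.exposure_eq {x : Assortment n w m} (hx : Feasible d x) (i : Fin n) :
    ∀ (z : Fin m) (k : Fin w), x i k z = true →
      rank (Finset.univ.filter fun z => ∃ k, x i k z = true) z = k := by
  set y := Finset.univ.filter fun z => ∃ k, x i k z = true with hy
  have huniq : ∀ z k k', x i k z = true → x i k' z = true → k = k' := by
    intro z k k' h h'
    by_contra hne
    have h1 := hx.once z i
    have h2 : ∑ k ∈ {k, k'}, (x i k z).toNat ≤ ∑ k, (x i k z).toNat :=
      Finset.sum_le_sum_of_subset (Finset.subset_univ _)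
    rw [Finset.sum_pair hne, h, h'] at h2
    simp at h2
    omega
  intro z
  induction z using WellFoundedLT.induction with
  | ind z ih =>
    intro k hk
    have ho := hx.order i k z
    rw [hk, Bool.toNat_true, one_mul, one_mul] at ho
    rw [← Finset.Iio_insert, Finset.sum_insert (by simp)] at ho
    have hz : ∑ k' ∈ Finset.Iic k, (x i k' z).toNat = 1 := by
      rw [Finset.sum_eq_single_of_mem k (Finset.mem_Iic.2 le_rfl), hk]
      · rfl
      · intro b _ hb
        rw [Bool.toNat_eq_zero, Bool.eq_false_iff]
        exact fun h => hb (huniq z _ _ h hk)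
    have hbelow : ∑ z' ∈ Finset.Iio z, ∑ k' ∈ Finset.Iic k, (x i k' z').toNat =
        ∑ k' ∈ Finset.Iic k, if k'.val < (y ∩ Finset.Iio z).card then 1 else 0 := by
      rw [Finset.sum_comm]
      refine Finset.sum_congr rfl fun k' _ => ?_
      rw [← sum_exposure (isLowerSet_Iio z)]
      refine Finset.sum_congr rfl fun z' hz' => ?_
      congr 1
      rw [Bool.eq_iff_iff, exposure_iff]
      constructor
      · intro h
        exact ⟨by simp only [hy, Finset.mem_filter, Finset.mem_univ, true_and]; exact ⟨k', h⟩,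
          ih z' (Finset.mem_Iio.1 hz') k' h⟩
      · rintro ⟨h1, h2⟩
        obtain ⟨k'', h3⟩ : ∃ k, x i k z' = true := by simpa [hy] using h1
        have := ih z' (Finset.mem_Iio.1 hz') k'' h3
        have : k'' = k' := Fin.ext (this.symm.trans h2)
        rwa [← this]
    rw [hz, hbelow, ← rank_eq_card_inter] at ho
    -- The sum is `min (k + 1) (rank y z)`, so it can equal `k` only if the rank is `k`.
    have hsum : ∑ k' ∈ Finset.Iic k, (if k'.val < rank y z then 1 else 0) = k.val := by omega
    rcases lt_trichotomy (rank y z) k.val with h | h | h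
    · exfalso
      let r : Fin w := ⟨rank y z, h.trans k.2⟩
      have h1 : ∑ k' ∈ Finset.Iic k, (if k'.val < rank y z then 1 else 0) ≤
          ∑ k' ∈ Finset.Iio r, 1 := by
        rw [← Finset.sum_filter]
        refine Finset.sum_le_sum_of_subset fun a ha => ?_
        simp only [Finset.mem_filter] at ha
        exact Finset.mem_Iio.2 ha.2
      rw [hsum] at h1
      simp [r] at h1
      omega
    · exact h
    · exfalso
      rw [Finset.sum_congr rfl (g := fun _ => 1)] at hsum
      · simp at hsum
      · intro a ha
        have : a.val ≤ k.val := Fin.le_def.1 (Finset.mem_Iic.1 ha)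
        rw [if_pos (this.trans_lt h)]

theorem Feasible.exists_schedules {x : Assortment n w m} (hx : Feasible d x) :
    ∃ Y : Fin n → Finset (Fin m), Admissible w d Y ∧ x = ofSchedules w Y := by
  set Y : Fin n → Finset (Fin m) := fun i => Finset.univ.filter fun z => ∃ k, x i k z = true with hY
  have hxY : x = ofSchedules w Y := by
    funext i k z
    rw [Bool.eq_iff_iff, ofSchedules, exposure_iff]
    constructor
    · intro h
      exact ⟨by simp only [hY, Finset.mem_filter, Finset.mem_univ, true_and]; exact ⟨k, h⟩,
        hx.exposure_eq i z k h⟩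
    · rintro ⟨h1, h2⟩
      obtain ⟨k', h3⟩ : ∃ k, x i k z = true := by simpa [hY] using h1
      have : k' = k := Fin.ext ((hx.exposure_eq i z k' h3).symm.trans h2)
      rwa [← this]
  have hcard : ∀ i, (Y i).card ≤ w := by
    intro i
    by_contra! h
    obtain ⟨z, hz, hr⟩ := exists_rank_eq h
    obtain ⟨k, hk⟩ : ∃ k, x i k z = true := by simpa [hY] using hz
    have := hx.exposure_eq i z k hk
    have hk2 := k.2
    have : rank (Y i) z = k := this
    omega
  refine ⟨Y, ⟨hcard, fun z => ?_⟩, hxY⟩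
  refine le_trans (le_of_eq (Finset.sum_congr rfl fun i _ => ?_)) (hx.capacity z)
  rw [hxY]
  exact (sum_exposure_stage (hcard i) z).symm

/-- Showing less is admissible. -/
theorem Admissible.mono {Y Y' : Fin n → Finset (Fin m)} (hY : Admissible w d Y)
    (h : ∀ i, Y' i ⊆ Y i) : Admissible w d Y' where
  card_le i := (Finset.card_le_card (h i)).trans (hY.card_le i)
  capacity z := by
    refine le_trans (Finset.sum_le_sum fun i _ => ?_) (hY.capacity z)
    by_cases h1 : z ∈ Y' i
    · simp [h1, h i h1]
    · simp [h1]

end Schedules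

/-! ### Stage weights and stage revenues -/

namespace Model

variable {n w m m' d : ℕ} (M : Model n w)

theorem weight_pos (i : Fin n) (k : Fin w) : 0 < M.weight i k := Real.exp_pos _

theorem stageWeight_nonneg (x : Assortment n w m) (z : Fin m) : 0 ≤ M.stageWeight x z :=
  Finset.sum_nonneg fun i _ => Finset.sum_nonneg fun k _ =>
    mul_nonneg (Nat.cast_nonneg _) (M.weight_pos i k).le

/-- The sum of `γ` over the exposures displayed in stage `t`. -/
def stageRevWeight (x : Assortment n w m) (t : Fin m) : ℝ :=
  ∑ i, ∑ k, ((x i k t).toNat : ℝ) * M.revWeight i k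

/-- The contribution of stage `t` to `g`. -/
def stageRevenue (x : Assortment n w m) (t : Fin m) : ℝ :=
  M.stageRevWeight x t /
    ((1 + ∑ z ∈ Finset.Iio t, M.stageWeight x z) * (1 + ∑ z ∈ Finset.Iic t, M.stageWeight x z))

theorem patientRevenue_eq (x : Assortment n w m) :
    M.patientRevenue x = ∑ t, M.stageRevenue x t := rfl

theorem one_add_sum_stageWeight_pos (x : Assortment n w m) (L : Finset (Fin m)) :
    0 < 1 + ∑ z ∈ L, M.stageWeight x z :=
  add_pos_of_pos_of_nonneg one_pos (Finset.sum_nonneg fun z _ => M.stageWeight_nonneg x z)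

variable {M}

theorem revWeight_pos (hrev : ∀ i, 0 < M.rev i) (i : Fin n) (k : Fin w) : 0 < M.revWeight i k :=
  mul_pos (hrev i) (M.weight_pos i k)

theorem stageRevWeight_nonneg (hrev : ∀ i, 0 < M.rev i) (x : Assortment n w m) (t : Fin m) :
    0 ≤ M.stageRevWeight x t :=
  Finset.sum_nonneg fun i _ => Finset.sum_nonneg fun k _ =>
    mul_nonneg (Nat.cast_nonneg _) (revWeight_pos hrev i k).le

theorem stageRevenue_nonneg (hrev : ∀ i, 0 < M.rev i) (x : Assortment n w m) (t : Fin m) :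
    0 ≤ M.stageRevenue x t :=
  div_nonneg (stageRevWeight_nonneg hrev x t)
    (mul_nonneg (M.one_add_sum_stageWeight_pos x _).le (M.one_add_sum_stageWeight_pos x _).le)

variable (M) in
theorem sum_stageWeight_ofSchedules {L : Finset (Fin m)} (hL : IsLowerSet (L : Set (Fin m)))
    (Y : Fin n → Finset (Fin m)) :
    ∑ z ∈ L, M.stageWeight (ofSchedules w Y) z =
      ∑ i, ∑ k : Fin w, if k.val < (Y i ∩ L).card then M.weight i k else 0 := by
  simp only [stageWeight]
  rw [Finset.sum_comm]
  exact Finset.sum_congr rfl fun i _ => sum_sum_exposure_mul hL (Y i) (M.weight i)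

/-- The weight seen is a sum of positive terms over initial segments of exposures. The numbers of
stages may differ, to allow comparison with the one-stage problem. -/
theorem sum_stageWeight_le {L : Finset (Fin m)} (hL : IsLowerSet (L : Set (Fin m)))
    {L' : Finset (Fin m')} (hL' : IsLowerSet (L' : Set (Fin m')))
    {Y : Fin n → Finset (Fin m)} {Y' : Fin n → Finset (Fin m')}
    (h : ∀ i, (Y' i ∩ L').card ≤ (Y i ∩ L).card) :
    ∑ z ∈ L', M.stageWeight (ofSchedules w Y') z ≤ ∑ z ∈ L, M.stageWeight (ofSchedules w Y) z := by
  rw [sum_stageWeight_ofSchedules M hL, sum_stageWeight_ofSchedules M hL']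
  refine Finset.sum_le_sum fun i _ => Finset.sum_le_sum fun k _ => ?_
  have := M.weight_pos i k
  have := h i
  split_ifs
  · exact le_rfl
  · omega
  · positivity
  · exact le_rfl

/-- With burnout, the revenue of a stage does not decrease when its products have been displayed
less often before. -/
theorem stageRevenue_le (hrev : ∀ i, 0 < M.rev i) (hburn : M.Burnout)
    {Y : Fin n → Finset (Fin m)} {Y' : Fin n → Finset (Fin m')}
    (hY : ∀ i, (Y i).card ≤ w) (hY' : ∀ i, (Y' i).card ≤ w) {t : Fin m} {t' : Fin m'}
    (hmem : ∀ i, t' ∈ Y' i ↔ t ∈ Y i) (hrank : ∀ i, rank (Y' i) t' ≤ rank (Y i) t) :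
    M.stageRevenue (ofSchedules w Y) t ≤ M.stageRevenue (ofSchedules w Y') t' := by
  have h1 := sum_stageWeight_le (M := M) (isLowerSet_Iio t) (isLowerSet_Iio t') (Y := Y) (Y' := Y')
    fun i => by rw [← rank_eq_card_inter, ← rank_eq_card_inter]; exact hrank i
  have h2 := sum_stageWeight_le (M := M) (isLowerSet_Iic t) (isLowerSet_Iic t') (Y := Y) (Y' := Y')
    fun i => by
      rw [card_inter_Iic, card_inter_Iic]
      simp only [hmem]
      exact Nat.add_le_add_right (hrank i) _
  have h3 : M.stageRevWeight (ofSchedules w Y) t ≤ M.stageRevWeight (ofSchedules w Y') t' := by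
    refine Finset.sum_le_sum fun i _ => ?_
    simp only [ofSchedules]
    by_cases ht : t ∈ Y i
    · rw [sum_exposure_mul_of_mem (hY i) ht,
        sum_exposure_mul_of_mem (hY' i) ((hmem i).2 ht)]
      -- Fewer earlier displays mean an exposure of smaller index, whose weight is at least as large
      -- by burnout; the denominators need only the counts.
      refine mul_le_mul_of_nonneg_left (Real.exp_le_exp.2 (hburn i ?_)) (hrev i).le
      exact hrank i
    · simp [exposure_of_notMem ht, exposure_of_notMem (mt (hmem i).1 ht)]
  have p1 := M.one_add_sum_stageWeight_pos (ofSchedules w Y') (Finset.Iio t')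
  have p2 := M.one_add_sum_stageWeight_pos (ofSchedules w Y') (Finset.Iic t')
  refine div_le_div₀ (stageRevWeight_nonneg hrev _ _) h3 (mul_pos p1 p2) ?_
  exact mul_le_mul (by linarith) (by linarith) p2.le
    (M.one_add_sum_stageWeight_pos _ _).le

/-! ### Costs and patience -/

theorem stageCost_nonneg (hcost : ∀ i, 0 ≤ M.cost i) (x : Assortment n w m) (z : Fin m) :
    0 ≤ M.stageCost x z :=
  Finset.sum_nonneg fun i _ => Finset.sum_nonneg fun _ _ =>
    mul_nonneg (Nat.cast_nonneg _) (hcost i)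

/-- Patience cost of the stages before stage `t`. -/
def costBefore (M : Model n w) (x : Assortment n w m) (t : Fin m) : ℝ :=
  ∑ z ∈ Finset.Iio t, M.stageCost x z

theorem costBefore_nonneg (hcost : ∀ i, 0 ≤ M.cost i) (x : Assortment n w m) (t : Fin m) :
    0 ≤ M.costBefore x t := Finset.sum_nonneg fun z _ => stageCost_nonneg hcost x z

theorem costBefore_le_totalCost (hcost : ∀ i, 0 ≤ M.cost i) (x : Assortment n w m) (t : Fin m) :
    M.costBefore x t ≤ M.totalCost x :=
  Finset.sum_le_sum_of_subset_of_nonneg (Finset.subset_univ _)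
    fun z _ _ => stageCost_nonneg hcost x z

theorem survival_nonneg (q : ℝ) : 0 ≤ M.survival q := measureReal_nonneg

variable [IsProbabilityMeasure M.budget]

theorem survival_le_one (q : ℝ) : M.survival q ≤ 1 := measureReal_le_one

theorem survival_antitone : Antitone M.survival := fun _ _ h =>
  measureReal_mono (Set.Ici_subset_Ici.2 h)

theorem survival_zero (hB : ∀ᵐ b ∂M.budget, 0 ≤ b) : M.survival 0 = 1 := by
  rw [survival, measureReal_def, (mem_ae_iff_prob_eq_one measurableSet_Ici).1 hB]
  rfl

/-- Clear the denominator of the conditional probability. If `q₁` has survival zero, so does `q₁ +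
q₂`. -/
theorem survival_add_le (hpat : M.DecliningPatience) {q₁ q₂ : ℝ} (h₁ : 0 ≤ q₁) (h₂ : 0 ≤ q₂) :
    M.survival (q₁ + q₂) ≤ M.survival q₁ * M.survival q₂ := by
  have h := hpat q₁ q₂ h₁ h₂
  have hsub : Set.Ici (q₁ + q₂) ⊆ Set.Ici q₁ := Set.Ici_subset_Ici.2 (by linarith)
  rw [cond_apply measurableSet_Ici, Set.inter_eq_self_of_subset_right hsub] at h
  have h' : M.budget (Set.Ici (q₁ + q₂)) ≤ M.budget (Set.Ici q₁) * M.budget (Set.Ici q₂) := by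
    by_cases h0 : M.budget (Set.Ici q₁) = 0
    · rw [measure_mono_null hsub h0]; exact zero_le
    · rw [← ENNReal.mul_inv_cancel_left (b := M.budget (Set.Ici (q₁ + q₂))) h0
        (measure_ne_top _ _)]
      gcongr
  simp only [survival, measureReal_def, ← ENNReal.toReal_mul]
  exact ENNReal.toReal_mono (ENNReal.mul_ne_top (measure_ne_top _ _) (measure_ne_top _ _)) h'

/-! ### The choice probabilities -/

/-- Costs are nonnegative, so only the condition at the last stage before `t` binds. In the first
stage there is no condition, which agrees with the survival at `0` because the budget is almost
surely nonnegative. -/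
theorem budget_real_continues (hB : ∀ᵐ b ∂M.budget, 0 ≤ b) (hcost : ∀ i, 0 ≤ M.cost i)
    (x : Assortment n w m) (t : Fin m) :
    M.budget.real {b | ∀ s < t, ∑ z ∈ Finset.Iic s, M.stageCost x z ≤ b} =
      M.survival (M.costBefore x t) := by
  by_cases ht : t.val = 0
  · have h1 : ∀ s : Fin m, ¬ s < t := fun s hs => by
      have : s.val < t.val := hs
      omega
    have h2 : M.costBefore x t = 0 := by
      rw [costBefore, Finset.sum_eq_zero]
      intro z hz
      exact absurd (Finset.mem_Iio.1 hz) (h1 z)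
    rw [h2, survival_zero hB]
    have : {b : ℝ | ∀ s < t, ∑ z ∈ Finset.Iic s, M.stageCost x z ≤ b} = Set.univ :=
      Set.eq_univ_of_forall fun b s hs => absurd hs (h1 s)
    rw [this]; simp
  · rw [survival]
    congr 1
    ext b
    constructor
    · intro h
      let s : Fin m := ⟨t.val - 1, by omega⟩
      have hs : s < t := by
        show s.val < t.val
        simp only [s]; omega
      have : Finset.Iic s = Finset.Iio t := by
        ext a
        simp only [Finset.mem_Iic, Finset.mem_Iio, Fin.le_def, Fin.lt_def, s]
        omega
      have h' := h s hs
      rw [this] at h'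
      exact h'
    · intro h s hs
      refine le_trans ?_ (show M.costBefore x t ≤ b from h)
      refine Finset.sum_le_sum_of_subset_of_nonneg (fun a ha => ?_)
        fun z _ _ => stageCost_nonneg hcost x z
      exact Finset.mem_Iio.2 ((Finset.mem_Iic.1 ha).trans_lt hs)

theorem law_real_choiceSet (S T : Finset (Fin n × Fin w)) (q : Fin n × Fin w) {G : Set ℝ}
    (hG : MeasurableSet G) (hST : Disjoint S T) (hq : q ∈ T) :
    M.law.real {ω | ω.2.1 ∈ choiceSet S T q ω.1 ∧ ω.2.2 ∈ G} =
      M.weight q.1 q.2 / ((1 + ∑ p ∈ S, M.weight p.1 p.2) *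
        (1 + (∑ p ∈ S, M.weight p.1 p.2 + ∑ p ∈ T, M.weight p.1 p.2))) * M.budget.real G := by
  have hmeas : MeasurableSet {ω : ℝ × (Fin n × Fin w → ℝ) × ℝ |
      ω.2.1 ∈ choiceSet S T q ω.1 ∧ ω.2.2 ∈ G} := by
    refine MeasurableSet.inter ?_ ((measurable_snd.comp measurable_snd) hG)
    exact (measurable_fst.prodMk (measurable_fst.comp measurable_snd))
      (measurableSet_choiceSet S T q)
  rw [measureReal_def, law, Measure.prod_apply hmeas]
  have : ∀ c : ℝ, Prod.mk c ⁻¹' {ω : ℝ × (Fin n × Fin w → ℝ) × ℝ |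
      ω.2.1 ∈ choiceSet S T q ω.1 ∧ ω.2.2 ∈ G} = choiceSet S T q c ×ˢ G := fun c => rfl
  simp_rw [this, Measure.prod_prod]
  have hm : Measurable fun c : ℝ => Measure.pi (fun p : Fin n × Fin w => gumbel (M.loc p.1 p.2))
      (choiceSet S T q c) := measurable_measure_prodMk_left (measurableSet_choiceSet S T q)
  rw [lintegral_mul_const _ hm,
    lintegral_gumbel_choiceSet (fun p : Fin n × Fin w => M.loc p.1 p.2) hST hq, ENNReal.toReal_mul,
    ENNReal.toReal_ofReal, measureReal_def]
  · rfl
  · positivity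

theorem choiceProb_eq (hB : ∀ᵐ b ∂M.budget, 0 ≤ b) (hcost : ∀ i, 0 ≤ M.cost i)
    {Y : Fin n → Finset (Fin m)} (hY : ∀ i, (Y i).card ≤ w) (i : Fin n) (t : Fin m) :
    M.choiceProb (ofSchedules w Y) i t =
      (∑ k, ((ofSchedules w Y i k t).toNat : ℝ) * M.weight i k) /
        ((1 + ∑ z ∈ Finset.Iio t, M.stageWeight (ofSchedules w Y) z) *
          (1 + ∑ z ∈ Finset.Iic t, M.stageWeight (ofSchedules w Y) z)) *
        M.survival (M.costBefore (ofSchedules w Y) t) := by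
  by_cases ht : t ∈ Y i
  swap
  · have h0 : ∀ k, ofSchedules w Y i k t = false := exposure_of_notMem ht
    have : {ω : ℝ × (Fin n × Fin w → ℝ) × ℝ |
        M.Purchases (ofSchedules w Y) ω.1 ω.2.1 ω.2.2 i t} = ∅ := by
      ext ω
      simp [Purchases, h0]
    simp [choiceProb, this, h0]
  set q : Fin n × Fin w := (i, ⟨rank (Y i) t, (rank_lt_card ht).trans_le (hY i)⟩) with hq
  -- `S` collects the exposures seen before stage `t`, and `T` below those of stage `t`; they are
  -- disjoint because an exposure displayed at `t` has index equal to its number of earlier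
  -- displays.
  set S : Finset (Fin n × Fin w) :=
    Finset.univ.filter fun p => p.2.val < (Y p.1 ∩ Finset.Iio t).card with hS
  set T : Finset (Fin n × Fin w) :=
    Finset.univ.filter fun p => exposure w (Y p.1) p.2 t = true with hT
  have hqT : q ∈ T := by
    simp only [hT, Finset.mem_filter, Finset.mem_univ, true_and]
    exact exposure_iff.2 ⟨ht, rfl⟩
  have hST : Disjoint S T := by
    rw [Finset.disjoint_left]
    intro p hpS hpT
    simp only [hS, hT, Finset.mem_filter, Finset.mem_univ, true_and] at hpS hpT
    rw [← rank_eq_card_inter, (exposure_iff.1 hpT).2] at hpS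
    exact lt_irrefl _ hpS
  have hSsum : ∑ z ∈ Finset.Iio t, M.stageWeight (ofSchedules w Y) z =
      ∑ p ∈ S, M.weight p.1 p.2 := by
    rw [sum_stageWeight_ofSchedules M (isLowerSet_Iio t), hS, Finset.sum_filter,
      Fintype.sum_prod_type]
  have hTsum : M.stageWeight (ofSchedules w Y) t = ∑ p ∈ T, M.weight p.1 p.2 := by
    rw [hT, Finset.sum_filter, Fintype.sum_prod_type]
    refine Finset.sum_congr rfl fun j _ => Finset.sum_congr rfl fun k _ => ?_
    simp only [ofSchedules]
    cases exposure w (Y j) k t <;> simp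
  have hset : {ω : ℝ × (Fin n × Fin w → ℝ) × ℝ |
      M.Purchases (ofSchedules w Y) ω.1 ω.2.1 ω.2.2 i t} =
      {ω | ω.2.1 ∈ choiceSet S T q ω.1 ∧ ω.2.2 ∈
        {b | ∀ s < t, ∑ z ∈ Finset.Iic s, M.stageCost (ofSchedules w Y) z ≤ b}} := by
    ext ω
    have hSiff : (∀ s < t, ∀ j k, ofSchedules w Y j k s = true → ω.2.1 (j, k) ≤ ω.1) ↔
        ∀ p ∈ S, ω.2.1 p ≤ ω.1 := by
      constructor
      · intro h p hp
        simp only [hS, Finset.mem_filter, Finset.mem_univ, true_and] at hp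
        obtain ⟨s, hs, he⟩ := (exists_exposure_iff (isLowerSet_Iio t)).2 hp
        exact h s (Finset.mem_Iio.1 hs) p.1 p.2 he
      · intro h s hs j k he
        refine h (j, k) ?_
        simp only [hS, Finset.mem_filter, Finset.mem_univ, true_and]
        exact (exists_exposure_iff (isLowerSet_Iio t)).1 ⟨s, Finset.mem_Iio.2 hs, he⟩
    have hTiff : (∃ k, ofSchedules w Y i k t = true ∧ ω.1 < ω.2.1 (i, k) ∧
        ∀ j l, ofSchedules w Y j l t = true → ω.2.1 (j, l) ≤ ω.2.1 (i, k)) ↔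
        ω.1 < ω.2.1 q ∧ ∀ p ∈ T, ω.2.1 p ≤ ω.2.1 q := by
      constructor
      · rintro ⟨k, hk, h1, h2⟩
        have : (i, k) = q := by
          rw [hq, Prod.mk.injEq]
          exact ⟨rfl, Fin.ext (exposure_iff.1 hk).2.symm⟩
        rw [this] at h1 h2
        refine ⟨h1, fun p hp => h2 p.1 p.2 ?_⟩
        simpa [hT, ofSchedules] using hp
      · rintro ⟨h1, h2⟩
        refine ⟨q.2, exposure_iff.2 ⟨ht, rfl⟩, h1, fun j l hjl => h2 (j, l) ?_⟩
        simp only [hT, Finset.mem_filter, Finset.mem_univ, true_and]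
        exact hjl
    simp only [Set.mem_ofPred_eq, Purchases, choiceSet, ← hSiff, hTiff, imp_and, forall_and]
    tauto
  have hG : MeasurableSet
      {b : ℝ | ∀ s < t, ∑ z ∈ Finset.Iic s, M.stageCost (ofSchedules w Y) z ≤ b} := by
    simp only [Set.ofPred_forall]
    exact MeasurableSet.iInter fun s => MeasurableSet.iInter fun _ => measurableSet_Ici
  have hnum : ∑ k, ((ofSchedules w Y i k t).toNat : ℝ) * M.weight i k = M.weight q.1 q.2 :=
    sum_exposure_mul_of_mem (hY i) ht (M.weight i)
  rw [choiceProb, hset, law_real_choiceSet S T q hG hST hqT, budget_real_continues hB hcost, hnum,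
    ← Finset.Iio_insert, Finset.sum_insert (by simp), hSsum, hTsum,
    add_comm (∑ p ∈ T, M.weight p.1 p.2)]

theorem expectedRevenue_ofSchedules (hB : ∀ᵐ b ∂M.budget, 0 ≤ b) (hcost : ∀ i, 0 ≤ M.cost i)
    {Y : Fin n → Finset (Fin m)} (hY : ∀ i, (Y i).card ≤ w) :
    M.expectedRevenue (ofSchedules w Y) = ∑ t, M.survival (M.costBefore (ofSchedules w Y) t) *
      M.stageRevenue (ofSchedules w Y) t := by
  refine Finset.sum_congr rfl fun t _ => ?_
  simp_rw [choiceProb_eq hB hcost hY, stageRevenue, stageRevWeight, revWeight, Finset.sum_div,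
    Finset.mul_sum]
  refine Finset.sum_congr rfl fun i _ => ?_
  rw [Finset.sum_mul, Finset.sum_mul]
  refine Finset.sum_congr rfl fun k _ => ?_
  ring

theorem expectedRevenue_eq (hB : ∀ᵐ b ∂M.budget, 0 ≤ b) (hcost : ∀ i, 0 ≤ M.cost i)
    {x : Assortment n w m} (hx : Feasible d x) :
    M.expectedRevenue x = ∑ t, M.survival (M.costBefore x t) * M.stageRevenue x t := by
  obtain ⟨Y, hY, rfl⟩ := hx.exists_schedules
  exact expectedRevenue_ofSchedules hB hcost hY.card_le

end Model

/-! ### Rounding -/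

section StageSum

variable {n w m d : ℕ}

/-- The sum of `a` over the exposures displayed in stage `z`. -/
def stageSum (a : Fin n → Fin w → ℝ) (x : Assortment n w m) (z : Fin m) : ℝ :=
  ∑ i, ∑ k, ((x i k z).toNat : ℝ) * a i k

variable {a b : Fin n → Fin w → ℝ} {x y : Assortment n w m} {z : Fin m}

theorem stageSum_mono (h : ∀ i k, a i k ≤ b i k) : stageSum a x z ≤ stageSum b x z :=
  Finset.sum_le_sum fun i _ => Finset.sum_le_sum fun k _ =>
    mul_le_mul_of_nonneg_left (h i k) (Nat.cast_nonneg _)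

theorem stageSum_add : stageSum (fun i k => a i k + b i k) x z = stageSum a x z + stageSum b x z := by
  simp only [stageSum, mul_add, Finset.sum_add_distrib]

theorem stageSum_mul (c : ℝ) : stageSum (fun i k => a i k * c) x z = stageSum a x z * c := by
  simp only [stageSum, Finset.sum_mul, mul_assoc]

theorem stageSum_const (c : ℝ) :
    stageSum (fun _ _ => c) x z = stageSum (fun _ _ => 1) x z * c := by
  rw [← stageSum_mul]; simp

theorem stageSum_le_ceil (δ : ℝ) :
    stageSum a x z / δ ≤ stageSum (fun i k => (⌈a i k / δ⌉ : ℝ)) x z := by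
  rw [div_eq_mul_inv, ← stageSum_mul]
  exact stageSum_mono fun i k => by rw [← div_eq_mul_inv]; exact Int.le_ceil _

theorem stageSum_ceil_le (δ : ℝ) : stageSum (fun i k => (⌈a i k / δ⌉ : ℝ)) x z ≤
    stageSum a x z / δ + stageSum (fun _ _ => 1) x z := by
  rw [div_eq_mul_inv, ← stageSum_mul, ← stageSum_add]
  exact stageSum_mono fun i k => by rw [← div_eq_mul_inv]; exact (Int.ceil_lt_add_one _).le

theorem stageSum_floor_le (δ : ℝ) :
    stageSum (fun i k => (⌊a i k / δ⌋ : ℝ)) x z ≤ stageSum a x z / δ := by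
  rw [div_eq_mul_inv, ← stageSum_mul]
  exact stageSum_mono fun i k => by rw [← div_eq_mul_inv]; exact Int.floor_le _

theorem stageSum_le_floor (δ : ℝ) : stageSum a x z / δ ≤
    stageSum (fun i k => (⌊a i k / δ⌋ : ℝ)) x z + stageSum (fun _ _ => 1) x z := by
  rw [div_eq_mul_inv, ← stageSum_mul, ← stageSum_add]
  exact stageSum_mono fun i k => by rw [← div_eq_mul_inv]; exact (Int.lt_floor_add_one _).le

/-- Rounding up adds at most one unit `δ` per exposure. Equal rounded sums and equal counts thus
bound the loss by the count times `δ`. -/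
theorem sub_le_stageSum_of_ceil_eq {δ : ℝ} (hδ : 0 < δ)
    (h : stageSum (fun i k => (⌈a i k / δ⌉ : ℝ)) x z = stageSum (fun i k => (⌈a i k / δ⌉ : ℝ)) y z)
    (hN : stageSum (fun _ _ => 1) x z = stageSum (fun _ _ => 1) y z) :
    stageSum a y z - stageSum (fun _ _ => 1) y z * δ ≤ stageSum a x z := by
  have h1 := stageSum_le_ceil (a := a) (x := y) (z := z) δ
  have h2 := stageSum_ceil_le (a := a) (x := x) (z := z) δ
  rw [← h] at h1
  have h3 := h1.trans h2
  rw [hN, div_add' _ _ _ hδ.ne', div_le_div_iff_of_pos_right hδ] at h3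
  linarith

theorem stageSum_le_add_of_floor_eq {δ : ℝ} (hδ : 0 < δ)
    (h : stageSum (fun i k => (⌊a i k / δ⌋ : ℝ)) x z = stageSum (fun i k => (⌊a i k / δ⌋ : ℝ)) y z)
    (hN : stageSum (fun _ _ => 1) x z = stageSum (fun _ _ => 1) y z) :
    stageSum a x z ≤ stageSum a y z + stageSum (fun _ _ => 1) y z * δ := by
  have h1 := stageSum_floor_le (a := a) (x := y) (z := z) δ
  have h2 := stageSum_le_floor (a := a) (x := x) (z := z) δ
  rw [h, hN] at h2
  have h3 := h2.trans (add_le_add_left h1 _)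
  rw [div_add' _ _ _ hδ.ne', div_le_div_iff_of_pos_right hδ] at h3
  linarith

theorem exists_of_stageSum_ne_zero (h : stageSum a x z ≠ 0) : ∃ i k, x i k z = true := by
  by_contra! hx
  refine h (Finset.sum_eq_zero fun i _ => Finset.sum_eq_zero fun k _ => ?_)
  rw [Bool.eq_false_iff.2 (hx i k)]
  simp

theorem le_stageSum {lo : ℝ} (hlo : ∀ i k, lo ≤ a i k) (ha : ∀ i k, 0 ≤ a i k) {i : Fin n}
    {k : Fin w} (h : x i k z = true) : lo ≤ stageSum a x z := by
  have h1 : ((x i k z).toNat : ℝ) * a i k ≤ ∑ k, ((x i k z).toNat : ℝ) * a i k :=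
    Finset.single_le_sum (f := fun k => ((x i k z).toNat : ℝ) * a i k)
      (fun k _ => mul_nonneg (Nat.cast_nonneg _) (ha i k)) (Finset.mem_univ k)
  have h2 : ∑ k, ((x i k z).toNat : ℝ) * a i k ≤ stageSum a x z :=
    Finset.single_le_sum (f := fun i => ∑ k, ((x i k z).toNat : ℝ) * a i k)
      (fun i _ => Finset.sum_nonneg fun k _ => mul_nonneg (Nat.cast_nonneg _) (ha i k))
      (Finset.mem_univ i)
  rw [h] at h1
  simp only [Bool.toNat_true, Nat.cast_one, one_mul] at h1
  exact (hlo i k).trans (h1.trans h2)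

/-- Origin of `ε(1 + ε)`: at most `d` errors of size `s ε / d` total `ε s`, and the guess `s`
overshoots by at most a factor `1 + ε`. A stage with zero sum is empty, so there the guess is
irrelevant. -/
theorem count_mul_le {lo : ℝ} (hlo0 : 0 < lo) (hlo : ∀ i k, lo ≤ a i k) (hd : 0 < d)
    (hN : stageSum (fun _ _ => 1) x z ≤ d) {ε s : ℝ} (hε : 0 < ε) (hs0 : 0 < s)
    (hs : stageSum a x z ≠ 0 → s ≤ (1 + ε) * stageSum a x z) :
    stageSum (fun _ _ => 1) x z * (s * ε / d) ≤ ε * (1 + ε) * stageSum a x z := by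
  have hd' : (0 : ℝ) < d := Nat.cast_pos.2 hd
  by_cases h : stageSum a x z = 0
  · have h1 : stageSum (fun _ _ => lo) x z ≤ stageSum a x z := stageSum_mono hlo
    rw [stageSum_const, h] at h1
    rw [h, mul_zero]
    refine mul_nonpos_of_nonpos_of_nonneg ?_ (by positivity)
    by_contra! hc
    nlinarith
  · calc stageSum (fun _ _ => 1) x z * (s * ε / d) ≤ d * (s * ε / d) :=
          mul_le_mul_of_nonneg_right hN (by positivity)
      _ = ε * s := by field_simp
      _ ≤ ε * ((1 + ε) * stageSum a x z) := mul_le_mul_of_nonneg_left (hs h) hε.le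
      _ = _ := by ring

end StageSum

/-! ### Geometric grids of guesses -/

namespace Model

theorem exists_mem_grid {d : ℕ} {ε lo hi v : ℝ} (hε : 0 < ε) (hε1 : ε ≤ 1) (hlo : 0 < lo)
    (hv : lo ≤ v) (hv' : v ≤ d * hi) : ∃ s ∈ grid d ε lo hi, v ≤ s ∧ s ≤ (1 + ε) * v := by
  have hb : 1 < 1 + ε := by linarith
  have hb0 : 0 < 1 + ε := by linarith
  have hv0 : 0 < v := hlo.trans_le hv
  have hr : 1 ≤ v / lo := (one_le_div hlo).2 hv
  have hr0 : 0 < v / lo := by positivity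
  have hlog : 0 ≤ Real.logb (1 + ε) (v / lo) := Real.logb_nonneg hb hr
  -- The exponent is that of the first grid point not below `v`. The grid starts at exponent `1`, so
  -- the maximum matters when `v = lo`; the overshoot is then exactly `1 + ε`.
  refine ⟨_, ⟨max 1 ⌈Real.logb (1 + ε) (v / lo)⌉₊, le_max_left _ _, ?_, rfl⟩, ?_, ?_⟩
  · refine max_le_max le_rfl (Nat.ceil_mono (Real.logb_le_logb_of_le hb hr0 ?_))
    rw [div_le_div_iff₀ hlo (by positivity)]
    -- Here `ε ≤ 1` is needed: the grid then extends far enough to cover `d * hi`.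
    have : v * ε ≤ d * hi := by nlinarith
    nlinarith
  · have h1 : v / lo ≤ (1 + ε) ^ (max 1 ⌈Real.logb (1 + ε) (v / lo)⌉₊) := by
      rw [← Real.rpow_natCast, ← Real.logb_le_iff_le_rpow hb hr0]
      exact (Nat.le_ceil _).trans (Nat.cast_le.2 (le_max_right _ _))
    rwa [div_le_iff₀' hlo] at h1
  · rcases le_total ⌈Real.logb (1 + ε) (v / lo)⌉₊ 1 with h | h
    · rw [max_eq_left h, pow_one, mul_comm]
      exact mul_le_mul_of_nonneg_left hv hb0.le
    · rw [max_eq_right h]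
      have h1 : (1 + ε) ^ ⌈Real.logb (1 + ε) (v / lo)⌉₊ ≤ v / lo * (1 + ε) := by
        rw [← Real.rpow_natCast]
        refine (Real.rpow_le_rpow_of_exponent_le hb.le (Nat.ceil_lt_add_one hlog).le).trans ?_
        rw [Real.rpow_add hb0, Real.rpow_one, Real.rpow_logb hb0 hb.ne' hr0]
      calc lo * (1 + ε) ^ ⌈Real.logb (1 + ε) (v / lo)⌉₊ ≤ lo * (v / lo * (1 + ε)) :=
            mul_le_mul_of_nonneg_left h1 hlo.le
        _ = (1 + ε) * v := by field_simp

theorem grid_nonempty (d : ℕ) (ε lo hi : ℝ) : (grid d ε lo hi).Nonempty :=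
  ⟨_, 1, le_rfl, le_max_left _ _, rfl⟩

theorem pos_of_mem_grid {d : ℕ} {ε lo hi s : ℝ} (hε : 0 < ε) (hlo : 0 < lo)
    (h : s ∈ grid d ε lo hi) : 0 < s := by
  obtain ⟨a, -, -, rfl⟩ := h
  positivity

variable {n w m d : ℕ}

theorem exists_guess {a : Fin n → Fin w → ℝ} {lo hi ε : ℝ} (hε : 0 < ε) (hε1 : ε ≤ 1)
    (hlo0 : 0 < lo) (hlo : ∀ i k, lo ≤ a i k) (hhi : ∀ i k, a i k ≤ hi) {x : Assortment n w m}
    {z : Fin m} (hN : stageSum (fun _ _ => 1) x z ≤ d) :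
    ∃ s ∈ grid d ε lo hi, stageSum a x z ≤ s ∧
      (stageSum a x z ≠ 0 → s ≤ (1 + ε) * stageSum a x z) := by
  by_cases h : stageSum a x z = 0
  · obtain ⟨s, hs⟩ := grid_nonempty d ε lo hi
    exact ⟨s, hs, h ▸ (pos_of_mem_grid hε hlo0 hs).le, fun h' => absurd h h'⟩
  · obtain ⟨i, k, hik⟩ := exists_of_stageSum_ne_zero h
    have h1 := le_stageSum hlo (fun i k => hlo0.le.trans (hlo i k)) hik
    have h2 : stageSum a x z ≤ d * hi := by
      refine (stageSum_mono hhi).trans ?_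
      rw [stageSum_const]
      exact mul_le_mul_of_nonneg_right hN (hlo0.le.trans ((hlo i k).trans (hhi i k)))
    obtain ⟨s, hs, h3, h4⟩ := exists_mem_grid hε hε1 hlo0 h1 h2
    exact ⟨s, hs, h3, fun _ => h4⟩

/-! ### The dynamic programming table -/

variable {M : Model n w}

theorem totalCost_ofSchedules {Y : Fin n → Finset (Fin m)} (hY : ∀ i, (Y i).card ≤ w) :
    M.totalCost (ofSchedules w Y) = ∑ i, ((Y i).card : ℝ) * M.cost i := by
  simp only [totalCost, stageCost]
  rw [Finset.sum_comm]
  refine Finset.sum_congr rfl fun i _ => ?_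
  simp_rw [← Finset.sum_mul]
  congr 1
  have : ∀ z, ∑ k, ((ofSchedules w Y i k z).toNat : ℝ) = if z ∈ Y i then 1 else 0 := by
    intro z
    rw [← Nat.cast_sum]
    rw [show ∑ k, (ofSchedules w Y i k z).toNat = _ from sum_exposure_stage (hY i) z]
    split_ifs <;> simp
  simp [this]

/-- The cell reached by the schedules `Y`. -/
def cellOf (M : Model n w) (d : ℕ) (ε : ℝ) (μ ν : Fin m → ℝ) (Y : Fin n → Finset (Fin m)) :
    Cell m := ∑ i, M.contribution d ε μ ν i (Y i)

section Cells

variable {ε : ℝ} {μ ν : Fin m → ℝ} {Y Z : Fin n → Finset (Fin m)}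

theorem cellOf_fst (z : Fin m) : ((M.cellOf d ε μ ν Y).1 z : ℝ) =
    stageSum (fun i k => (⌈M.revWeight i k / (μ z * ε / d)⌉ : ℝ)) (ofSchedules w Y) z := by
  simp [cellOf, contribution, stageSum, ofSchedules, Prod.fst_sum, Finset.sum_apply]

theorem cellOf_snd_fst (z : Fin m) : ((M.cellOf d ε μ ν Y).2.1 z : ℝ) =
    stageSum (fun i k => (⌊M.weight i k / (ν z * ε / d)⌋ : ℝ)) (ofSchedules w Y) z := by
  simp [cellOf, contribution, stageSum, ofSchedules, Prod.fst_sum, Prod.snd_sum, Finset.sum_apply]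

theorem cellOf_snd_snd (z : Fin m) : ((M.cellOf d ε μ ν Y).2.2 z : ℝ) =
    stageSum (fun _ _ => 1) (ofSchedules w Y) z := by
  simp [cellOf, contribution, stageSum, ofSchedules, Prod.snd_sum, Finset.sum_apply]

theorem stageSum_one_ofSchedules (hY : ∀ i, (Y i).card ≤ w) (z : Fin m) :
    stageSum (fun _ _ => 1) (ofSchedules w Y) z = ((∑ i, if z ∈ Y i then 1 else 0 : ℕ) : ℝ) := by
  simp only [stageSum, mul_one]
  rw [Nat.cast_sum]
  refine Finset.sum_congr rfl fun i _ => ?_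
  rw [← Nat.cast_sum]
  exact congrArg Nat.cast (sum_exposure_stage (hY i) z)

theorem contribution_nonneg (hrev : ∀ i, 0 < M.rev i) (hε : 0 < ε) (hμ : ∀ z, 0 < μ z)
    (hν : ∀ z, 0 < ν z) (i : Fin n) (y : Finset (Fin m)) :
    0 ≤ M.contribution d ε μ ν i y := by
  have h1 : ∀ z k, 0 ≤ ⌈M.revWeight i k / (μ z * ε / d)⌉ := fun z k => by
    have := revWeight_pos hrev i k
    have := hμ z
    exact Int.ceil_nonneg (by positivity)
  have h2 : ∀ z k, 0 ≤ ⌊M.weight i k / (ν z * ε / d)⌋ := fun z k => by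
    have := M.weight_pos i k
    have := hν z
    exact Int.floor_nonneg.2 (by positivity)
  have h3 : ∀ (z : Fin m) (k : Fin w), (0 : ℤ) ≤ (exposure w y k z).toNat :=
    fun z k => Int.natCast_nonneg _
  refine ⟨fun z => ?_, fun z => ?_, fun z => ?_⟩
  · exact Finset.sum_nonneg (s := Finset.univ) fun k _ => mul_nonneg (h3 z k) (h1 z k)
  · exact Finset.sum_nonneg (s := Finset.univ) fun k _ => mul_nonneg (h3 z k) (h2 z k)
  · exact Finset.sum_nonneg (s := Finset.univ) fun k _ => h3 z k

theorem filter_lt_succ {j : ℕ} (hj : j < n) :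
    (Finset.univ.filter fun i : Fin n => i.val < j + 1) =
      insert ⟨j, hj⟩ (Finset.univ.filter fun i : Fin n => i.val < j) := by
  ext i
  simp only [Finset.mem_filter, Finset.mem_univ, true_and, Finset.mem_insert, Fin.ext_iff]
  omega

theorem filter_le_eq_insert (J : ℕ) {j : ℕ} (hj : j < n) (hJ : j < J) :
    (Finset.univ.filter fun i : Fin n => j ≤ i.val ∧ i.val < J) =
      insert ⟨j, hj⟩ (Finset.univ.filter fun i : Fin n => j + 1 ≤ i.val ∧ i.val < J) := by
  ext i
  simp only [Finset.mem_filter, Finset.mem_univ, true_and, Finset.mem_insert, Fin.ext_iff]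
  omega

/-- The given schedules compete in every minimum, and nonnegative contributions keep the partial
cells out of the region where the table is `⊤`. -/
theorem table_le (hc : ∀ i y, 0 ≤ M.contribution d ε μ ν i y) (hY : ∀ i, (Y i).card ≤ w) :
    ∀ j ≤ n, M.table d ε μ ν j
      (∑ i ∈ Finset.univ.filter (fun i : Fin n => i.val < j), M.contribution d ε μ ν i (Y i)) ≤
      ((∑ i ∈ Finset.univ.filter (fun i : Fin n => i.val < j), ((Y i).card : ℝ) * M.cost i : ℝ) :
        WithTop ℝ) := by
  intro j
  induction j with
  | zero => intro _; simp [table]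
  | succ j ih =>
    intro hj
    have hjn : j < n := hj
    rw [table, dif_pos hjn, if_pos (Finset.sum_nonneg fun i _ => hc i _)]
    refine (Finset.inf_le (b := Y ⟨j, hjn⟩) ?_).trans ?_
    · simp [schedules, hY]
    · rw [filter_lt_succ hjn, Finset.sum_insert (by simp), Finset.sum_insert (by simp),
        add_sub_cancel_left, WithTop.coe_add, add_comm (WithTop.some _)]
      exact add_le_add_left (ih hjn.le) _

theorem table_cellOf_le (hc : ∀ i y, 0 ≤ M.contribution d ε μ ν i y) (hY : ∀ i, (Y i).card ≤ w) :
    M.table d ε μ ν n (M.cellOf d ε μ ν Y) ≤ (M.totalCost (ofSchedules w Y) : WithTop ℝ) := by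
  have h := table_le hc hY n le_rfl
  simp only [Fin.is_lt, Finset.filter_true] at h
  rwa [totalCost_ofSchedules hY]

theorem IsTraceback.table_eq {s : Cell m} (h : M.IsTraceback d ε μ ν s Y) :
    ∀ j ≤ n, M.table d ε μ ν n s = M.table d ε μ ν j (M.remaining d ε μ ν s Y j) +
      ((∑ i ∈ Finset.univ.filter (fun i : Fin n => j ≤ i.val), ((Y i).card : ℝ) * M.cost i : ℝ) :
        WithTop ℝ) := by
  intro j hj
  induction hj using Nat.decreasingInduction with
  | self =>
    have : (Finset.univ.filter fun i : Fin n => n ≤ i.val) = ∅ := by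
      ext i; simp
    simp [remaining, this]
  | of_succ j hj ih =>
    have := filter_le_eq_insert n hj hj
    simp only [Fin.is_lt, and_true] at this
    rw [ih, (h ⟨j, hj⟩).2, this, Finset.sum_insert (by simp), WithTop.coe_add, add_assoc]

/-- The traceback equations telescope down to row `0`, which is finite only at the zero cell. So a
finite value means that the contributions exhaust `s` exactly. -/
theorem IsTraceback.eq_cellOf {s : Cell m} (h : M.IsTraceback d ε μ ν s Y)
    (hs : M.table d ε μ ν n s ≠ ⊤) :
    s = M.cellOf d ε μ ν Y ∧
      M.table d ε μ ν n s = ((∑ i, ((Y i).card : ℝ) * M.cost i : ℝ) : WithTop ℝ) := by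
  have h0 := h.table_eq 0 (Nat.zero_le n)
  simp only [Nat.zero_le, Finset.filter_true] at h0
  have hr : M.remaining d ε μ ν s Y 0 = 0 := by
    by_contra hne
    rw [table, if_neg hne, top_add] at h0
    exact hs h0
  constructor
  · rw [remaining] at hr
    simp only [Nat.zero_le, Finset.filter_true] at hr
    exact sub_eq_zero.1 hr
  · rw [h0, hr, table, if_pos rfl, zero_add]

/-- Induction on the row `J`, choosing the schedule of the last product first. Sums stop below `J`
because the schedules of later products are still arbitrary. -/
theorem exists_traceback_aux : ∀ J ≤ n, ∀ s : Cell m, M.table d ε μ ν J s ≠ ⊤ →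
    ∃ Y : Fin n → Finset (Fin m), ∀ j : Fin n, j.val < J → Y j ∈ schedules w m ∧
      M.table d ε μ ν (j.val + 1) (s - ∑ i ∈ Finset.univ.filter
          (fun i : Fin n => j.val + 1 ≤ i.val ∧ i.val < J), M.contribution d ε μ ν i (Y i)) =
        M.table d ε μ ν j.val (s - ∑ i ∈ Finset.univ.filter
          (fun i : Fin n => j.val ≤ i.val ∧ i.val < J), M.contribution d ε μ ν i (Y i)) +
        ((((Y j).card : ℝ) * M.cost j : ℝ) : WithTop ℝ) := by
  intro J
  induction J with
  | zero => exact fun _ s _ => ⟨fun _ => ∅, fun j hj => absurd hj (Nat.not_lt_zero _)⟩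
  | succ J ih =>
    intro hJ s hs
    have hJn : J < n := hJ
    have hne : (schedules w m).Nonempty := ⟨∅, by simp [schedules]⟩
    obtain ⟨y, hy, hmin⟩ := Finset.exists_mem_eq_inf (schedules w m) hne fun y =>
      M.table d ε μ ν J (s - M.contribution d ε μ ν ⟨J, hJn⟩ y) +
            (((y.card : ℝ) * M.cost ⟨J, hJn⟩ : ℝ) : WithTop ℝ)
    have hs0 : 0 ≤ s := by
      by_contra h
      rw [table, dif_pos hJn, if_neg h] at hs
      exact hs rfl
    have htable : M.table d ε μ ν (J + 1) s =
        M.table d ε μ ν J (s - M.contribution d ε μ ν ⟨J, hJn⟩ y) +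
            (((y.card : ℝ) * M.cost ⟨J, hJn⟩ : ℝ) : WithTop ℝ) := by
      rw [table, dif_pos hJn, if_pos hs0, hmin]
    have hfin : M.table d ε μ ν J (s - M.contribution d ε μ ν ⟨J, hJn⟩ y) ≠ ⊤ := by
      intro h
      rw [htable, h, top_add] at hs
      exact hs rfl
    obtain ⟨Y, hY⟩ := ih hJn.le _ hfin
    have hsum : ∀ j ≤ J, ∑ i ∈ Finset.univ.filter (fun i : Fin n => j ≤ i.val ∧ i.val < J + 1),
        M.contribution d ε μ ν i (Function.update Y ⟨J, hJn⟩ y i) =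
        M.contribution d ε μ ν ⟨J, hJn⟩ y + ∑ i ∈ Finset.univ.filter
          (fun i : Fin n => j ≤ i.val ∧ i.val < J), M.contribution d ε μ ν i (Y i) := by
      intro j hj
      have : (Finset.univ.filter fun i : Fin n => j ≤ i.val ∧ i.val < J + 1) =
          insert ⟨J, hJn⟩ (Finset.univ.filter fun i : Fin n => j ≤ i.val ∧ i.val < J) := by
        ext i
        simp only [Finset.mem_filter, Finset.mem_univ, true_and, Finset.mem_insert, Fin.ext_iff]
        omega
      rw [this, Finset.sum_insert (by simp), Function.update_self]
      congr 1
      refine Finset.sum_congr rfl fun i hi => ?_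
      rw [Function.update_of_ne]
      rintro rfl
      simp at hi
    refine ⟨Function.update Y ⟨J, hJn⟩ y, fun j hj => ?_⟩
    rcases Nat.lt_succ_iff_lt_or_eq.1 hj with h | h
    · have hjne : j ≠ ⟨J, hJn⟩ := fun he => by
        rw [he] at h; exact lt_irrefl _ h
      rw [Function.update_of_ne hjne, hsum _ h, hsum _ h.le, ← sub_sub, ← sub_sub]
      exact hY j h
    · obtain rfl : j = ⟨J, hJn⟩ := Fin.ext h
      refine ⟨by rwa [Function.update_self], ?_⟩
      have h1 : (Finset.univ.filter fun i : Fin n => J + 1 ≤ i.val ∧ i.val < J + 1) = ∅ := by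
        ext i
        simp
      have h2 : (Finset.univ.filter fun i : Fin n => J ≤ i.val ∧ i.val < J) = ∅ := by
        ext i
        simp
      rw [hsum J le_rfl, h1, h2, Function.update_self]
      simpa using htable

theorem exists_traceback {s : Cell m} (hs : M.table d ε μ ν n s ≠ ⊤) :
    ∃ Y, M.IsTraceback d ε μ ν s Y := by
  obtain ⟨Y, hY⟩ := exists_traceback_aux n le_rfl s hs
  simp only [Fin.is_lt, and_true, true_implies] at hY
  exact ⟨Y, hY⟩

theorem IsTraceback.card_le {s : Cell m} (h : M.IsTraceback d ε μ ν s Y) (i : Fin n) :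
    (Y i).card ≤ w := by
  simpa [schedules] using (h i).1

theorem IsTraceback.admissible {s : Cell m} (h : M.IsTraceback d ε μ ν s Y)
    (hs : M.Enumerated d ε μ ν s) : Admissible w d Y where
  card_le := h.card_le
  capacity z := by
    obtain ⟨-, -, -, -, -, hl, hfin⟩ := hs
    have h1 := hl z
    have h2 := cellOf_snd_snd (M := M) (d := d) (ε := ε) (μ := μ) (ν := ν) (Y := Y) z
    rw [stageSum_one_ofSchedules h.card_le, ← (h.eq_cellOf hfin).1] at h2
    have h3 : s.2.2 z = ((∑ i, if z ∈ Y i then 1 else 0 : ℕ) : ℤ) := by exact_mod_cast h2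
    rw [h3] at h1
    exact_mod_cast h1

/-- The table value at this cell equals the cost of `Y` and is at most the cost of `Z`. -/
theorem IsTraceback.totalCost_le (h : M.IsTraceback d ε μ ν (M.cellOf d ε μ ν Z) Y)
    (hs : M.table d ε μ ν n (M.cellOf d ε μ ν Z) ≠ ⊤)
    (hc : ∀ i y, 0 ≤ M.contribution d ε μ ν i y) (hZ : ∀ i, (Z i).card ≤ w) :
    M.totalCost (ofSchedules w Y) ≤ M.totalCost (ofSchedules w Z) := by
  have h1 := table_cellOf_le hc hZ
  rw [(h.eq_cellOf hs).2, WithTop.coe_le_coe] at h1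
  rwa [totalCost_ofSchedules h.card_le]

end Cells

end Model

namespace Model

/-! ### The approximation guarantee of the dynamic program -/

section DynamicProgram

variable {n w m d : ℕ} {M : Model n w} {ρ ε : ℝ}

theorem iInf_prod_pos (hn : 0 < n) (hw : 0 < w) {a : Fin n → Fin w → ℝ} (ha : ∀ i k, 0 < a i k) :
    0 < ⨅ p : Fin n × Fin w, a p.1 p.2 := by
  have : Nonempty (Fin n × Fin w) := ⟨(⟨0, hn⟩, ⟨0, hw⟩)⟩
  obtain ⟨p, hp⟩ := exists_eq_ciInf_of_finite (f := fun p : Fin n × Fin w => a p.1 p.2)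
  rw [← hp]
  exact ha _ _

theorem iInf_prod_le (a : Fin n → Fin w → ℝ) (i : Fin n) (k : Fin w) :
    ⨅ p : Fin n × Fin w, a p.1 p.2 ≤ a i k :=
  ciInf_le (Set.finite_range fun p : Fin n × Fin w => a p.1 p.2).bddBelow (i, k)

theorem le_iSup_prod (a : Fin n → Fin w → ℝ) (i : Fin n) (k : Fin w) :
    a i k ≤ ⨆ p : Fin n × Fin w, a p.1 p.2 :=
  le_ciSup (Set.finite_range fun p : Fin n × Fin w => a p.1 p.2).bddAbove (i, k)

theorem pos_of_mem_gridI (hn : 0 < n) (hw : 0 < w) (hrev : ∀ i, 0 < M.rev i) (hε : 0 < ε) {s : ℝ}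
    (hs : s ∈ M.gridI d ε) : 0 < s :=
  pos_of_mem_grid hε (iInf_prod_pos hn hw (revWeight_pos hrev)) hs

theorem pos_of_mem_gridJ (hn : 0 < n) (hw : 0 < w) (hε : 0 < ε) {s : ℝ}
    (hs : s ∈ M.gridJ d ε) : 0 < s :=
  pos_of_mem_grid hε (iInf_prod_pos hn hw M.weight_pos) hs

theorem stageSum_one_le {Z : Fin n → Finset (Fin m)} (hZ : Admissible w d Z) (z : Fin m) :
    stageSum (fun _ _ => 1) (ofSchedules w Z) z ≤ d := by
  rw [stageSum_one_ofSchedules hZ.card_le]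
  exact Nat.cast_le.2 (hZ.capacity z)

/-- Explains the index range of the table: scaling gives at most `d / ε`, rounding adds at most `d`,
and `1 ≤ d` absorbs the slack. -/
theorem rounded_le (hd : 0 < d) (hε : 0 < ε) {S s : ℝ} (hs : 0 < s) (hS : S ≤ s) :
    S / (s * ε / d) + d ≤ d * (d / ε + 1) := by
  have hd' : (1 : ℝ) ≤ d := by exact_mod_cast hd
  have h1 : S / (s * ε / d) ≤ d / ε := by
    rw [div_le_div_iff₀ (by positivity) hε]
    have : (d : ℝ) * (s * ε / d) = s * ε := by field_simp
    rw [this]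
    exact mul_le_mul_of_nonneg_right hS hε.le
  have h2 : (d : ℝ) / ε ≤ d * (d / ε) := le_mul_of_one_le_left (by positivity) hd'
  linarith

theorem enumerated_cellOf (hn : 0 < n) (hw : 0 < w) (hd : 0 < d) (hrev : ∀ i, 0 < M.rev i)
    (hε : 0 < ε) {μ ν : Fin m → ℝ} {Z : Fin n → Finset (Fin m)} (hZ : Admissible w d Z)
    (hμ : ∀ z, μ z ∈ M.gridI d ε) (hν : ∀ z, ν z ∈ M.gridJ d ε)
    (hZμ : ∀ z, stageSum M.revWeight (ofSchedules w Z) z ≤ μ z)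
    (hZν : ∀ z, stageSum M.weight (ofSchedules w Z) z ≤ ν z) :
    M.Enumerated d ε μ ν (M.cellOf d ε μ ν Z) := by
  have hμ0 : ∀ z, 0 < μ z := fun z => pos_of_mem_gridI hn hw hrev hε (hμ z)
  have hν0 : ∀ z, 0 < ν z := fun z => pos_of_mem_gridJ hn hw hε (hν z)
  have hc := contribution_nonneg (M := M) (d := d) hrev hε hμ0 hν0
  refine ⟨hμ, hν, Finset.sum_nonneg fun i _ => hc i _, fun z => ?_, fun z => ?_, fun z => ?_, ?_⟩
  · rw [cellOf_fst]
    refine (stageSum_ceil_le _).trans (le_trans ?_ (rounded_le hd hε (hμ0 z) (hZμ z)))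
    exact add_le_add_right (stageSum_one_le hZ z) _
  · rw [cellOf_snd_fst]
    refine (stageSum_floor_le _).trans (le_trans ?_ (rounded_le hd hε (hν0 z) (hZν z)))
    exact le_add_of_nonneg_right (Nat.cast_nonneg _)
  · have h := stageSum_one_le hZ z
    rw [← cellOf_snd_snd (M := M) (d := d) (ε := ε) (μ := μ) (ν := ν)] at h
    exact_mod_cast h
  · exact ne_top_of_le_ne_top WithTop.coe_ne_top (table_cellOf_le hc hZ.card_le)

theorem IsDPSolution.feasible {x : Assortment n w m} (hx : M.IsDPSolution d ρ ε x) :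
    Feasible d x := by
  obtain ⟨sol, hsol, -, ⟨μ, ν, s, hs, rfl⟩, -⟩ := hx
  exact ((hsol μ ν s hs).admissible hs).feasible

/-- Each numerator keeps at least a factor `1 - η`, and each of the two factors of the denominator
grows by at most `1 + η`. -/
theorem patientRevenue_ge_of_rounding (hrev : ∀ i, 0 < M.rev i) {η : ℝ} (hη : 0 ≤ η)
    {x y : Assortment n w m}
    (hγ : ∀ z, (1 - η) * M.stageRevWeight y z ≤ M.stageRevWeight x z)
    (hβ : ∀ z, M.stageWeight x z ≤ (1 + η) * M.stageWeight y z) :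
    (1 - η) / (1 + η) ^ 2 * M.patientRevenue y ≤ M.patientRevenue x := by
  rw [patientRevenue_eq, patientRevenue_eq, Finset.mul_sum]
  refine Finset.sum_le_sum fun t _ => ?_
  have hL : ∀ L : Finset (Fin m),
      1 + ∑ z ∈ L, M.stageWeight x z ≤ (1 + η) * (1 + ∑ z ∈ L, M.stageWeight y z) := by
    intro L
    have := Finset.sum_le_sum fun z (_ : z ∈ L) => hβ z
    rw [← Finset.mul_sum] at this
    linarith
  have p1 := M.one_add_sum_stageWeight_pos x (Finset.Iio t)
  have p2 := M.one_add_sum_stageWeight_pos x (Finset.Iic t)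
  rw [stageRevenue, stageRevenue, div_mul_div_comm]
  refine div_le_div₀ (stageRevWeight_nonneg hrev _ _) (hγ t) (mul_pos p1 p2) ?_
  calc _ ≤ ((1 + η) * (1 + ∑ z ∈ Finset.Iio t, M.stageWeight y z)) *
        ((1 + η) * (1 + ∑ z ∈ Finset.Iic t, M.stageWeight y z)) :=
        mul_le_mul (hL _) (hL _) p2.le (p1.le.trans (hL _))
    _ = _ := by ring

variable [IsProbabilityMeasure M.budget]

theorem withinPatience_traceback (hn : 0 < n) (hw : 0 < w) (hrev : ∀ i, 0 < M.rev i) (hε : 0 < ε)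
    {μ ν : Fin m → ℝ} {Y Z : Fin n → Finset (Fin m)} (hZ : Admissible w d Z)
    (hs : M.Enumerated d ε μ ν (M.cellOf d ε μ ν Z))
    (hY : M.IsTraceback d ε μ ν (M.cellOf d ε μ ν Z) Y)
    (hρ : M.WithinPatience ρ (ofSchedules w Z)) : M.WithinPatience ρ (ofSchedules w Y) := by
  have hμ0 : ∀ z, 0 < μ z := fun z => pos_of_mem_gridI hn hw hrev hε (hs.1 z)
  have hν0 : ∀ z, 0 < ν z := fun z => pos_of_mem_gridJ hn hw hε (hs.2.1 z)
  exact le_trans hρ (survival_antitone (hY.totalCost_le hs.2.2.2.2.2.2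
    (contribution_nonneg hrev hε hμ0 hν0) hZ.card_le))

theorem exists_isDPSolution (hn : 0 < n) (hw : 0 < w) (hd : 0 < d)
    (hB : ∀ᵐ b ∂M.budget, 0 ≤ b) (hrev : ∀ i, 0 < M.rev i) (hρ : ρ ≤ 1) (hε : 0 < ε) :
    ∃ x : Assortment n w m, M.IsDPSolution d ρ ε x := by
  have hex : ∀ (μ ν : Fin m → ℝ) (s : Cell m), ∃ Y : Fin n → Finset (Fin m),
      M.Enumerated d ε μ ν s → M.IsTraceback d ε μ ν s Y := by
    intro μ ν s
    by_cases hs : M.Enumerated d ε μ ν s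
    · obtain ⟨Y, hY⟩ := exists_traceback hs.2.2.2.2.2.2
      exact ⟨Y, fun _ => hY⟩
    · exact ⟨fun _ => ∅, fun h => absurd h hs⟩
  choose sol hsol using hex
  let C : Set (Assortment n w m) := {x | ∃ μ ν s, M.Enumerated d ε μ ν s ∧
    M.WithinPatience ρ (ofSchedules w (sol μ ν s)) ∧ x = ofSchedules w (sol μ ν s)}
  -- Trace back from the cell of the empty assortment: the result costs no more than `0`, where the
  -- survival is `1 ≥ ρ`.
  have hC : C.Nonempty := by
    obtain ⟨s, hs⟩ := grid_nonempty d ε (⨅ p : Fin n × Fin w, M.revWeight p.1 p.2)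
      (⨆ p : Fin n × Fin w, M.revWeight p.1 p.2)
    obtain ⟨t, ht⟩ := grid_nonempty d ε (⨅ p : Fin n × Fin w, M.weight p.1 p.2)
      (⨆ p : Fin n × Fin w, M.weight p.1 p.2)
    have hZ : Admissible w d fun _ : Fin n => (∅ : Finset (Fin m)) :=
      ⟨fun _ => by simp, fun _ => by simp⟩
    have h0 : ∀ (a : Fin n → Fin w → ℝ) z,
        stageSum a (ofSchedules w fun _ : Fin n => (∅ : Finset (Fin m))) z = 0 := by
      intro a z
      simp [stageSum, ofSchedules, exposure_of_notMem]
    have he := enumerated_cellOf (μ := fun _ => s) (ν := fun _ => t) hn hw hd hrev hε hZ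
      (fun _ => hs) (fun _ => ht)
      (fun z => by rw [h0]; exact (pos_of_mem_gridI hn hw hrev hε hs).le)
      (fun z => by rw [h0]; exact (pos_of_mem_gridJ hn hw hε ht).le)
    refine ⟨_, _, _, _, he, withinPatience_traceback hn hw hrev hε hZ he (hsol _ _ _ he) ?_, rfl⟩
    rw [WithinPatience, totalCost_ofSchedules hZ.card_le]
    simpa [survival_zero hB] using hρ
  obtain ⟨x, ⟨μ, ν, s, hs, hwp, hx⟩, hmax⟩ :=
    Set.exists_max_image C M.patientRevenue (Set.toFinite C) hC
  exact ⟨x, sol, hsol, hx ▸ hwp, ⟨μ, ν, s, hs, hx⟩,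
    fun μ ν s hs hwp => hmax _ ⟨μ, ν, s, hs, hwp, rfl⟩⟩

theorem IsDPSolution.patientRevenue_ge (hn : 0 < n) (hw : 0 < w) (hd : 0 < d)
    (hrev : ∀ i, 0 < M.rev i) (hε : 0 < ε) (hε1 : ε * (1 + ε) ≤ 1) {x : Assortment n w m}
    (hx : M.IsDPSolution d ρ ε x) {Z : Fin n → Finset (Fin m)} (hZ : Admissible w d Z)
    (hρ : M.WithinPatience ρ (ofSchedules w Z)) :
    (1 - ε * (1 + ε)) / (1 + ε * (1 + ε)) ^ 2 * M.patientRevenue (ofSchedules w Z) ≤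
      M.patientRevenue x := by
  have hε1' : ε ≤ 1 := by nlinarith
  have hN := stageSum_one_le (m := m) hZ
  have hlo := iInf_prod_pos hn hw (revWeight_pos hrev)
  have hlo' := iInf_prod_pos hn hw M.weight_pos
  choose μ hμ hμ1 hμ2 using fun z => exists_guess (x := ofSchedules w Z) (z := z) hε hε1' hlo
    (iInf_prod_le M.revWeight) (le_iSup_prod M.revWeight) (hN z)
  choose ν hν hν1 hν2 using fun z => exists_guess (x := ofSchedules w Z) (z := z) hε hε1' hlo'
    (iInf_prod_le M.weight) (le_iSup_prod M.weight) (hN z)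
  have he := enumerated_cellOf hn hw hd hrev hε hZ hμ hν hμ1 hν1
  obtain ⟨sol, hsol, -, -, hmax⟩ := hx
  have hY := hsol _ _ _ he
  -- With guesses fitted to `Z`, the traceback from the cell of `Z` is a competitor of `x`, so it
  -- suffices to compare that traceback with `Z`.
  refine le_trans ?_ (hmax _ _ _ he (withinPatience_traceback hn hw hrev hε hZ he hY hρ))
  have hcell := (hY.eq_cellOf he.2.2.2.2.2.2).1
  have hμ0 : ∀ z, 0 < μ z := fun z => pos_of_mem_gridI hn hw hrev hε (hμ z)
  have hν0 : ∀ z, 0 < ν z := fun z => pos_of_mem_gridJ hn hw hε (hν z)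
  generalize sol μ ν (M.cellOf d ε μ ν Z) = Y at hcell
  have hd' : (0 : ℝ) < d := Nat.cast_pos.2 hd
  have hcount : ∀ z, stageSum (fun _ _ => 1) (ofSchedules w Y) z =
      stageSum (fun _ _ => 1) (ofSchedules w Z) z := fun z => by
    rw [← cellOf_snd_snd (M := M) (d := d) (ε := ε) (μ := μ) (ν := ν), ← hcell, cellOf_snd_snd]
  refine patientRevenue_ge_of_rounding hrev (by positivity) (fun z => ?_) fun z => ?_
  · have hδ : 0 < μ z * ε / d := by have := hμ0 z; positivity
    have h1 := sub_le_stageSum_of_ceil_eq hδ (a := M.revWeight) (x := ofSchedules w Y)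
      (y := ofSchedules w Z) (z := z)
      (by rw [← cellOf_fst (ν := ν), ← hcell, cellOf_fst]) (hcount z)
    have h2 := count_mul_le hlo (iInf_prod_le M.revWeight) hd (hN z) hε (hμ0 z) (hμ2 z)
    show _ * stageSum M.revWeight _ z ≤ stageSum M.revWeight _ z
    linarith
  · have hδ : 0 < ν z * ε / d := by have := hν0 z; positivity
    have h1 := stageSum_le_add_of_floor_eq hδ (a := M.weight) (x := ofSchedules w Y)
      (y := ofSchedules w Z) (z := z)
      (by rw [← cellOf_snd_fst (μ := μ), ← hcell, cellOf_snd_fst]) (hcount z)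
    have h2 := count_mul_le hlo' (iInf_prod_le M.weight) hd (hN z) hε (hν0 z) (hν2 z)
    show stageSum M.weight _ z ≤ _ * stageSum M.weight _ z
    linarith

end DynamicProgram

/-! ### Decomposition of an optimal assortment -/

section Decomposition

variable {n w m d : ℕ} {M : Model n w} {ρ : ℝ}

/-- The schedules `Y` restricted to the stages `a, …, b - 1`. -/
def window (Y : Fin n → Finset (Fin m)) (a b : ℕ) : Fin n → Finset (Fin m) :=
  fun i => (Y i).filter fun z => a ≤ z.val ∧ z.val < b

theorem window_subset (Y : Fin n → Finset (Fin m)) (a b : ℕ) (i : Fin n) : window Y a b i ⊆ Y i :=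
  Finset.filter_subset _ _

theorem rank_mono {y y' : Finset (Fin m)} (h : y' ⊆ y) (z : Fin m) : rank y' z ≤ rank y z :=
  Finset.card_le_card (Finset.filter_subset_filter _ h)

theorem rank_eq_zero (y : Finset (Fin m)) {z : Fin m} (hz : z.val = 0) : rank y z = 0 := by
  rw [rank, Finset.card_eq_zero, Finset.filter_eq_empty_iff]
  intro a _ h
  have : a.val < z.val := h
  omega

theorem stageRevenue_le_window (hrev : ∀ i, 0 < M.rev i) (hburn : M.Burnout)
    {Y : Fin n → Finset (Fin m)} (hY : Admissible w d Y) {a b : ℕ} {t : Fin m} (ha : a ≤ t.val)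
    (hb : t.val < b) : M.stageRevenue (ofSchedules w Y) t ≤
      M.stageRevenue (ofSchedules w (window Y a b)) t :=
  stageRevenue_le hrev hburn hY.card_le (hY.mono (window_subset Y a b)).card_le
    (fun i => by simp [window, ha, hb]) (fun i => rank_mono (window_subset Y a b i) t)

theorem stageCost_ofSchedules {Y : Fin n → Finset (Fin m)} (hY : ∀ i, (Y i).card ≤ w) (z : Fin m) :
    M.stageCost (ofSchedules w Y) z = ∑ i, if z ∈ Y i then M.cost i else 0 := by
  refine Finset.sum_congr rfl fun i _ => ?_
  rw [← Finset.sum_mul, ← Nat.cast_sum,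
    show ∑ k, (ofSchedules w Y i k z).toNat = _ from sum_exposure_stage (hY i) z]
  split_ifs <;> simp

theorem stageCost_window {Y : Fin n → Finset (Fin m)} (hY : Admissible w d Y) (a b : ℕ)
    (z : Fin m) : M.stageCost (ofSchedules w (window Y a b)) z =
      if a ≤ z.val ∧ z.val < b then M.stageCost (ofSchedules w Y) z else 0 := by
  rw [stageCost_ofSchedules hY.card_le,
    stageCost_ofSchedules (hY.mono (window_subset Y a b)).card_le]
  split_ifs with h
  · simp [window, h]
  · simp [window, h]

/-- Patience cost of the first `s` stages. -/
def costUpTo (M : Model n w) (x : Assortment n w m) (s : ℕ) : ℝ :=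
  ∑ z ∈ Finset.univ.filter (fun z : Fin m => z.val < s), M.stageCost x z

theorem costBefore_eq (x : Assortment n w m) (t : Fin m) :
    M.costBefore x t = M.costUpTo x t.val := by
  refine Finset.sum_congr ?_ fun _ _ => rfl
  ext z
  simp

theorem totalCost_window_zero {Y : Fin n → Finset (Fin m)} (hY : Admissible w d Y) (s : ℕ) :
    M.totalCost (ofSchedules w (window Y 0 s)) = M.costUpTo (ofSchedules w Y) s := by
  simp [totalCost, costUpTo, stageCost_window hY, Finset.sum_filter]

theorem costBefore_window {Y : Fin n → Finset (Fin m)} (hY : Admissible w d Y) {s : ℕ} {t : Fin m}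
    (hs : s ≤ t.val) : M.costBefore (ofSchedules w Y) t = M.costUpTo (ofSchedules w Y) s +
      M.costBefore (ofSchedules w (window Y s m)) t := by
  rw [costBefore_eq, costBefore_eq]
  simp only [costUpTo, Finset.sum_filter, ← Finset.sum_add_distrib, stageCost_window hY]
  refine Finset.sum_congr rfl fun z _ => ?_
  have := z.2
  by_cases h1 : z.val < s
  · have h2 : z.val < t.val := h1.trans_le hs
    simp [h1, h2]
  · simp [h1, not_lt.1 h1]

theorem costUpTo_nonneg (hcost : ∀ i, 0 ≤ M.cost i) (x : Assortment n w m) (s : ℕ) :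
    0 ≤ M.costUpTo x s := Finset.sum_nonneg fun z _ => stageCost_nonneg hcost x z

theorem expectedRevenue_nonneg (hrev : ∀ i, 0 < M.rev i) (x : Assortment n w m) :
    0 ≤ M.expectedRevenue x :=
  Finset.sum_nonneg fun _ _ => Finset.sum_nonneg fun i _ =>
    mul_nonneg measureReal_nonneg (hrev i).le

theorem feasible_empty : Feasible d (ofSchedules w fun _ : Fin n => (∅ : Finset (Fin m))) :=
  Admissible.feasible ⟨fun _ => by simp, fun _ => by simp⟩

variable (M d m) in
theorem exists_isOptimal : ∃ x : Assortment n w m, M.IsOptimal d x := by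
  obtain ⟨x, hx, hmax⟩ := Set.exists_max_image {x : Assortment n w m | Feasible d x}
    M.expectedRevenue (Set.toFinite _) ⟨_, feasible_empty⟩
  exact ⟨x, hx, hmax⟩

/-- The one-stage schedules `Y` moved to the first of `m` stages. -/
def firstStage (hm : 0 < m) (Y : Fin n → Finset (Fin 1)) : Fin n → Finset (Fin m) :=
  fun i => if 0 ∈ Y i then {⟨0, hm⟩} else ∅

theorem mem_firstStage (hm : 0 < m) (Y : Fin n → Finset (Fin 1)) (i : Fin n) (z : Fin m) :
    z ∈ firstStage hm Y i ↔ z.val = 0 ∧ 0 ∈ Y i := by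
  rw [firstStage]
  split_ifs with h <;> simp [h, Fin.ext_iff]

theorem inFirstStage_ofSchedules (hm : 0 < m) (Y : Fin n → Finset (Fin 1)) :
    inFirstStage m (ofSchedules w Y) = ofSchedules w (firstStage hm Y) := by
  funext i k z
  rw [Bool.eq_iff_iff, inFirstStage, ofSchedules, ofSchedules, exposure_iff, mem_firstStage]
  split_ifs with h
  · rw [exposure_iff, rank_eq_zero _ h, rank_eq_zero _ (Fin.val_zero 1)]
    simp [h]
  · simp [h]

theorem admissible_firstStage (hw : 0 < w) (hm : 0 < m) {Y : Fin n → Finset (Fin 1)}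
    (hY : Admissible w d Y) : Admissible w d (firstStage hm Y) where
  card_le i := by
    rw [firstStage]
    split_ifs
    · exact (Finset.card_singleton _).trans_le hw
    · simp
  capacity z := by
    refine le_trans (Finset.sum_le_sum fun i _ => ?_) (hY.capacity 0)
    by_cases h : 0 ∈ Y i
    · rw [if_pos h]; split_ifs <;> simp
    · simp [mem_firstStage, h]

theorem feasible_inFirstStage (hw : 0 < w) (hm : 0 < m) {x : Assortment n w 1}
    (hx : Feasible d x) : Feasible d (inFirstStage m x) := by
  obtain ⟨Y, hY, rfl⟩ := hx.exists_schedules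
  rw [inFirstStage_ofSchedules hm]
  exact (admissible_firstStage hw hm hY).feasible

variable [IsProbabilityMeasure M.budget]

theorem survival_costBefore_zero (hB : ∀ᵐ b ∂M.budget, 0 ≤ b) (x : Assortment n w m) {t : Fin m}
    (ht : t.val = 0) : M.survival (M.costBefore x t) = 1 := by
  rw [costBefore_eq, ht]
  simp [costUpTo, survival_zero hB]

theorem stageRevenue_le_expectedRevenue_of_first (hB : ∀ᵐ b ∂M.budget, 0 ≤ b)
    (hcost : ∀ i, 0 ≤ M.cost i) (hrev : ∀ i, 0 < M.rev i) {x : Assortment n w m}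
    (hx : Feasible d x) {t : Fin m} (ht : t.val = 0) :
    M.stageRevenue x t ≤ M.expectedRevenue x := by
  rw [expectedRevenue_eq hB hcost hx]
  refine le_trans (le_of_eq ?_) (Finset.single_le_sum (fun t _ => mul_nonneg (survival_nonneg _)
    (stageRevenue_nonneg hrev x t)) (Finset.mem_univ t))
  rw [survival_costBefore_zero hB x ht, one_mul]

theorem expectedRevenue_le_inFirstStage (hw : 0 < w) (hm : 0 < m)
    (hB : ∀ᵐ b ∂M.budget, 0 ≤ b) (hcost : ∀ i, 0 ≤ M.cost i) (hrev : ∀ i, 0 < M.rev i)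
    (hburn : M.Burnout) {x : Assortment n w 1} (hx : Feasible d x) :
    M.expectedRevenue x ≤ M.expectedRevenue (inFirstStage m x) := by
  refine le_trans ?_ (stageRevenue_le_expectedRevenue_of_first hB hcost hrev
    (feasible_inFirstStage hw hm hx) (t := ⟨0, hm⟩) rfl)
  rw [expectedRevenue_eq hB hcost hx, Fin.sum_univ_one, survival_costBefore_zero hB x rfl, one_mul]
  obtain ⟨Y, hY, rfl⟩ := hx.exists_schedules
  rw [inFirstStage_ofSchedules hm]
  refine stageRevenue_le hrev hburn hY.card_le (admissible_firstStage hw hm hY).card_le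
    (fun i => by simp [mem_firstStage]) fun i => ?_
  rw [rank_eq_zero _ rfl]
  exact Nat.zero_le _

/-- A single stage earns at most the optimum of the one-stage problem. -/
theorem stageRevenue_le_of_isOptimal (hw : 0 < w)
    (hB : ∀ᵐ b ∂M.budget, 0 ≤ b) (hcost : ∀ i, 0 ≤ M.cost i) (hrev : ∀ i, 0 < M.rev i)
    (hburn : M.Burnout) {x : Assortment n w 1} (hx : M.IsOptimal d x)
    {Y : Fin n → Finset (Fin m)} (hY : Admissible w d Y) (t : Fin m) :
    M.stageRevenue (ofSchedules w Y) t ≤ M.expectedRevenue x := by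
  -- Display exactly the products of stage `t`, all with their first exposure.
  let Y1 : Fin n → Finset (Fin 1) := fun i => if t ∈ Y i then {0} else ∅
  have hmem : ∀ i (z : Fin 1), z ∈ Y1 i ↔ t ∈ Y i := by
    intro i z
    rw [Subsingleton.elim z 0]
    simp only [Y1]
    split_ifs with h <;> simp [h]
  have hY1 : Admissible w d Y1 := by
    refine ⟨fun i => ?_, fun z => ?_⟩
    · exact (Finset.card_le_univ _).trans ((Fintype.card_fin 1).trans_le hw)
    · simpa only [hmem] using hY.capacity t
  refine le_trans (stageRevenue_le hrev hburn hY.card_le hY1.card_le (t' := 0)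
    (fun i => hmem i 0) fun i => ?_) ((stageRevenue_le_expectedRevenue_of_first hB hcost hrev
      hY1.feasible rfl).trans (hx.2 _ hY1.feasible))
  rw [rank_eq_zero _ rfl]
  exact Nat.zero_le _

/-- No stage is preceded by more than the total cost, so every survival factor is at least `ρ`. -/
theorem mul_patientRevenue_le (hB : ∀ᵐ b ∂M.budget, 0 ≤ b) (hcost : ∀ i, 0 ≤ M.cost i)
    (hrev : ∀ i, 0 < M.rev i) {x : Assortment n w m} (hx : Feasible d x)
    (hρ : M.WithinPatience ρ x) : ρ * M.patientRevenue x ≤ M.expectedRevenue x := by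
  rw [expectedRevenue_eq hB hcost hx, patientRevenue_eq, Finset.mul_sum]
  refine Finset.sum_le_sum fun t _ => mul_le_mul_of_nonneg_right ?_ (stageRevenue_nonneg hrev x t)
  exact le_trans hρ (survival_antitone (costBefore_le_totalCost hcost x t))

/-- The expected revenue of an assortment is at most that of an initial part within the patience
constraint, plus that of a single stage, plus `ρ` times that of the remaining stages when these are
displayed to a new consumer. -/
theorem exists_decomposition (hw : 0 < w) (hm : 0 < m)
    (hB : ∀ᵐ b ∂M.budget, 0 ≤ b) (hcost : ∀ i, 0 ≤ M.cost i) (hrev : ∀ i, 0 < M.rev i)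
    (hpat : M.DecliningPatience) (hburn : M.Burnout) (hρ0 : 0 ≤ ρ) (hρ1 : ρ ≤ 1)
    {x : Assortment n w 1} (hx : M.IsOptimal d x)
    {Y : Fin n → Finset (Fin m)} (hY : Admissible w d Y) :
    ∃ Y₁ Y₂ : Fin n → Finset (Fin m), Admissible w d Y₁ ∧ Admissible w d Y₂ ∧
      M.WithinPatience ρ (ofSchedules w Y₁) ∧
      M.expectedRevenue (ofSchedules w Y) ≤ M.patientRevenue (ofSchedules w Y₁) +
        M.expectedRevenue (inFirstStage m x) + ρ * M.expectedRevenue (ofSchedules w Y₂) := by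
  classical
  set P : ℕ → Prop := fun s => ρ ≤ M.survival (M.costUpTo (ofSchedules w Y) s) with hP
  have hP0 : P 0 := by simpa [hP, costUpTo, survival_zero hB] using hρ1
  -- Stages are numbered from `0`, so stage `s` is the first to push the survival below `ρ`. If `s =
  -- m`, there is neither a crossing stage nor a remainder.
  set s := Nat.findGreatest P m with hs
  have hPs : P s := Nat.findGreatest_spec (Nat.zero_le m) hP0
  have hW1 := hY.mono (window_subset Y 0 s)
  have hW2 := hY.mono (window_subset Y (s + 1) m)
  refine ⟨window Y 0 s, window Y (s + 1) m, hW1, hW2, ?_, ?_⟩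
  · rw [WithinPatience, totalCost_window_zero hY]
    exact hPs
  · set R := M.expectedRevenue (inFirstStage m x)
    have hR : 0 ≤ R := expectedRevenue_nonneg hrev _
    have hsingle : ∑ t : Fin m, (if t.val = s then R else 0) ≤ R := by
      by_cases hsm : s < m
      · rw [Finset.sum_eq_single ⟨s, hsm⟩]
        · simp
        · intro t _ ht
          rw [if_neg fun h => ht (Fin.ext h)]
        · simp
      · rw [Finset.sum_eq_zero]
        · exact hR
        · intro t _
          rw [if_neg (by omega)]
    rw [expectedRevenue_eq hB hcost hY.feasible, expectedRevenue_eq hB hcost hW2.feasible]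
    have hterm : ∀ t : Fin m, M.survival (M.costBefore (ofSchedules w Y) t) *
        M.stageRevenue (ofSchedules w Y) t ≤ M.stageRevenue (ofSchedules w (window Y 0 s)) t +
        (if t.val = s then R else 0) +
        ρ * (M.survival (M.costBefore (ofSchedules w (window Y (s + 1) m)) t) *
          M.stageRevenue (ofSchedules w (window Y (s + 1) m)) t) := by
      intro t
      have h1 := stageRevenue_nonneg hrev (ofSchedules w (window Y 0 s)) t
      have h2 := stageRevenue_nonneg hrev (ofSchedules w Y) t
      have h3 : 0 ≤ M.survival (M.costBefore (ofSchedules w (window Y (s + 1) m)) t) *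
          M.stageRevenue (ofSchedules w (window Y (s + 1) m)) t :=
        mul_nonneg (survival_nonneg _) (stageRevenue_nonneg hrev _ t)
      have h3' := mul_nonneg hρ0 h3
      have h4 : M.survival (M.costBefore (ofSchedules w Y) t) *
        M.stageRevenue (ofSchedules w Y) t ≤ M.stageRevenue (ofSchedules w Y) t :=
        mul_le_of_le_one_left h2 (survival_le_one _)
      rcases lt_trichotomy t.val s with h | h | h
      · have := stageRevenue_le_window hrev hburn hY (Nat.zero_le t.val) h
        rw [if_neg h.ne]
        linarith
      · have h5 := stageRevenue_le_of_isOptimal hw hB hcost hrev hburn hx hY t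
        have h6 := expectedRevenue_le_inFirstStage hw hm hB hcost hrev hburn hx.1
        rw [if_pos h]
        linarith
      · rw [if_neg h.ne', costBefore_window hY (Nat.succ_le_of_lt h)]
        -- The cost through the crossing stage has survival below `ρ`; declining patience extracts
        -- this factor from every later stage.
        have h5 : ¬ P (s + 1) :=
          Nat.findGreatest_is_greatest (Nat.lt_succ_self s) ((Nat.succ_le_of_lt h).trans t.2.le)
        have h6 := survival_add_le hpat (costUpTo_nonneg hcost (ofSchedules w Y) (s + 1))
          (costBefore_nonneg hcost (ofSchedules w (window Y (s + 1) m)) t)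
        have h7 := stageRevenue_le_window hrev hburn hY (Nat.succ_le_of_lt h) t.2
        have h8 : M.survival (M.costUpTo (ofSchedules w Y) (s + 1) +
            M.costBefore (ofSchedules w (window Y (s + 1) m)) t) ≤
            ρ * M.survival (M.costBefore (ofSchedules w (window Y (s + 1) m)) t) :=
          h6.trans (mul_le_mul_of_nonneg_right (not_le.1 h5).le (survival_nonneg _))
        have h9 := mul_le_mul h8 h7 h2 (mul_nonneg hρ0 (survival_nonneg _))
        rw [mul_assoc] at h9
        linarith
    refine (Finset.sum_le_sum fun t _ => hterm t).trans ?_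
    rw [Finset.sum_add_distrib, Finset.sum_add_distrib, ← Finset.mul_sum, ← patientRevenue_eq]
    linarith

end Decomposition

end Model

end Cascade

end

/-! ### The guarantee of ACME -/

theorem mainTheorem4 {n w m d : ℕ} (hn : 0 < n) (hw : 0 < w) (hm : 0 < m) (hd : 0 < d)
    (M : Cascade.Model n w) [MeasureTheory.IsProbabilityMeasure M.budget]
    (hB : ∀ᵐ b ∂M.budget, 0 ≤ b) (hcost : ∀ i, 0 ≤ M.cost i) (hrev : ∀ i, 0 < M.rev i)
    (hpatience : M.DecliningPatience) (hburnout : M.Burnout)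
    (ρ ε : ℝ) (hρ : ρ ∈ Set.Icc (0 : ℝ) 1) (hε : 0 < ε) :
    (∃ x : Cascade.Assortment n w m, M.IsACMEOutput d ρ ε x) ∧
      ∀ x : Cascade.Assortment n w m, M.IsACMEOutput d ρ ε x →
        Cascade.Feasible d x ∧
          ∀ y : Cascade.Assortment n w m, Cascade.Feasible d y →
            ρ * (1 - ρ) * (1 - ε * (1 + ε)) / (2 * (1 + ε * (1 + ε)) ^ 2) * M.expectedRevenue y ≤
              M.expectedRevenue x := by
  obtain ⟨hρ0, hρ1⟩ := hρ
  constructor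
  · obtain ⟨x', hx'⟩ := Cascade.Model.exists_isDPSolution (m := m) hn hw hd hB hrev hρ1 hε
    obtain ⟨x'', hx''⟩ := Cascade.Model.exists_isOptimal 1 d M
    rcases le_total (M.expectedRevenue (Cascade.inFirstStage m x'')) (M.expectedRevenue x')
      with h | h
    · exact ⟨x', x', x'', hx', hx'', Or.inl ⟨rfl, h⟩⟩
    · exact ⟨_, x', x'', hx', hx'', Or.inr ⟨rfl, h⟩⟩
  · rintro x ⟨x', x'', hx', hx'', hx⟩
    have hle' : M.expectedRevenue x' ≤ M.expectedRevenue x := by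
      rcases hx with ⟨rfl, h⟩ | ⟨rfl, h⟩
      exacts [le_rfl, h]
    have hle'' : M.expectedRevenue (Cascade.inFirstStage m x'') ≤ M.expectedRevenue x := by
      rcases hx with ⟨rfl, h⟩ | ⟨rfl, h⟩
      exacts [h, le_rfl]
    refine ⟨?_, fun y hy => ?_⟩
    · rcases hx with ⟨rfl, -⟩ | ⟨rfl, -⟩
      exacts [hx'.feasible, Cascade.Model.feasible_inFirstStage hw hm hx''.1]
    have hfx : 0 ≤ M.expectedRevenue x := Cascade.Model.expectedRevenue_nonneg hrev x
    set η := ε * (1 + ε) with hη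
    have hη0 : 0 < η := by positivity
    -- For `η > 1` the claimed factor is at most zero, while revenues are nonnegative.
    by_cases hη1 : η ≤ 1
    swap
    · refine le_trans (mul_nonpos_of_nonpos_of_nonneg (div_nonpos_of_nonpos_of_nonneg ?_
        (by positivity)) (Cascade.Model.expectedRevenue_nonneg hrev y)) hfx
      exact mul_nonpos_of_nonneg_of_nonpos (mul_nonneg hρ0 (by linarith)) (by linarith)
    obtain ⟨z, hz⟩ := Cascade.Model.exists_isOptimal m d M
    obtain ⟨Z, hZ, rfl⟩ := hz.1.exists_schedules
    obtain ⟨Y₁, Y₂, hY₁, hY₂, hpat, hdec⟩ := Cascade.Model.exists_decomposition hw hm hB hcost hrev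
      hpatience hburnout hρ0 hρ1 hx'' hZ
    set κ := (1 - η) / (1 + η) ^ 2 with hκ
    have hκ0 : 0 ≤ κ := div_nonneg (by linarith) (by positivity)
    have hκ1 : κ ≤ 1 := by
      rw [hκ, div_le_one (by positivity)]
      nlinarith
    have h1 : κ * M.patientRevenue (Cascade.ofSchedules w Y₁) ≤ M.patientRevenue x' :=
      hx'.patientRevenue_ge hn hw hd hrev hε hη1 hY₁ hpat
    have h2 : ρ * M.patientRevenue x' ≤ M.expectedRevenue x' :=
      Cascade.Model.mul_patientRevenue_le hB hcost hrev hx'.feasible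
        (by obtain ⟨_, _, h, _⟩ := hx'; exact h)
    have h3 := hz.2 _ hY₂.feasible
    have h4 := hz.2 _ hy
    set V := M.expectedRevenue (Cascade.ofSchedules w Z)
    set X := M.expectedRevenue x
    -- The remaining stages form a feasible assortment, so their share is at most `ρ * V` and moves
    -- to the left.
    have h5 : (1 - ρ) * V ≤ M.patientRevenue (Cascade.ofSchedules w Y₁) + X := by
      have := mul_le_mul_of_nonneg_left h3 hρ0
      linarith
    -- The output dominates both candidates, so each of the two terms is at most `X`; this is the
    -- factor `2` in the ratio.
    have h6 : ρ * κ * ((1 - ρ) * V) ≤ 2 * X := by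
      have hρκ : 0 ≤ ρ * κ := mul_nonneg hρ0 hκ0
      have h7 := mul_le_mul_of_nonneg_left h5 hρκ
      have h8 := mul_le_mul_of_nonneg_left h1 hρ0
      have h9 : ρ * κ * X ≤ X := mul_le_of_le_one_left hfx (mul_le_one₀ hρ1 hκ0 hκ1)
      linarith
    have h10 : ρ * (1 - ρ) * (1 - η) / (2 * (1 + η) ^ 2) = ρ * κ * (1 - ρ) / 2 := by
      rw [hκ]; field_simp
    rw [h10]
    have h11 : ρ * κ * (1 - ρ) / 2 * M.expectedRevenue y ≤ ρ * κ * (1 - ρ) / 2 * V :=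
      mul_le_mul_of_nonneg_left h4
        (div_nonneg (mul_nonneg (mul_nonneg hρ0 hκ0) (by linarith)) (by norm_num))
    linarith
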